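/- Let $\log=\log_2$. For $k\mid n$ let $G_{n,k}$ be the graph on $n$ nodes consisting of $n/k$ cliques $C_1,\dots,C_{n/k}$ of size $k$, with a perfect matching between every two consecutive cliques such that the matching edges form $k$ disjoint paths from $C_1$ to $C_{n/k}$. Every node $v$ initially holds one message $m_v$. Time proceeds in synchronous rounds; in a round every node $u$ sends one message to all of its neighbours. Let $R_u$ be the set of messages known to $u$ (initially $\{m_u\}$), $S_u$ the set of messages already sent by $u$ (initially empty), and $cnt_{u,v}$ the number of times $u$ has received $m_v$ (initially $cnt_{u,u}=1$ and $cnt_{u,v}=0$ for $v\ne u$). The basic algorithm with parameters $\alpha,d$ runs as follows. In round $0$ every node $u$ sends $m_u$. Then there is one random phase of $\tau=\lceil\alpha\log n\rceil$ rounds, followed by consecutive ranking phases of $\tau'=\lceil 8d\tau\log^2 n\rceil$ rounds each. At the start of each phase, every node $u$ sets $\hat B_u:=R_u\setminus S_u$ and fixes a probability distribution on $\hat B_u$: the uniform one in the random phase; in a ranking phase, with $b=|\hat B_u|$ and $H_b=\sum_{i=1}^b 1/i$, the message at position $r$ in the list of $\hat B_u$ sorted increasingly by $cnt_{u,\cdot}$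 (ties broken arbitrarily) gets probability $\frac1{r\,H_b}$. In each round of the phase every node, independently of the other nodes, picks a message of $\hat B_u$ according to its distribution, removes it from $\hat B_u$ and sends it, and the probabilities of the remaining messages are renormalized (a node whose $\hat B_u$ is empty sends nothing). Theorem. Let $c\ge 1$, $\alpha>48c+96$ and $d>c+3$. There is a constant $C$ such that for every function $k=k(n)$ with $k=\omega(\log^3 n)$, for all sufficiently large $n$ with $k\mid n$, and for every way of breaking ties (which may depend on the current configuration), the following holds for the basic algorithm on $G_{n,k}$: with probability at least $1-\frac1{n^c}$, at the end of ranking phase number $n/k$ every node knows the messages of all nodes, and the number of rounds executed until then is at most $C\,\frac{n\log^3 n}{k}$. -/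

import Mathlib

open scoped ENNReal

namespace VertexCongest

/-- The global configuration of an execution on the node set `V`. The message originating at `v` is
identified with `v`. -/
@[ext]
structure Config (V : Type*) where
  /-- the number of rounds executed so far -/
  t : ℕ
  /-- `R u`: the messages received (known) by `u` -/
  R : V → Finset V
  /-- `S u`: the messages already sent by `u` -/
  S : V → Finset V
  /-- `cnt u v`: the number of times that `u` has received the message of `v` -/
  cnt : V → V → ℕ
  /-- `Bhat u`: the buffer of `u` in the current phase, fixed at the start of the phase and only
  shrinking during the phase -/
  Bhat : V → Finset V
  /-- `Prob u`: the probability space of `u`, computed at the start of the current phase -/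
  Prob : V → V → ℝ≥0∞

section Algorithm

variable {V : Type*} [Fintype V] [DecidableEq V]

/-- The start of the execution: every node knows exactly its own message. -/
def Config.init : Config V where
  t := 0
  R u := {u}
  S _ := ∅
  cnt u v := if v = u then 1 else 0
  Bhat _ := ∅
  Prob _ _ := 0

open Classical in
/-- A synchronized round on the graph `G`: every node `u` sends the message `x u` to all of its
neighbours (`x u = none` means that `u` has nothing to send) and receives what its neighbours send.
A sent message is removed from the buffer of the phase. -/
noncomputable def Config.syncRound (G : SimpleGraph V) (c : Config V) (x : V → Option V) :
    Config V where
  t := c.t + 1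
  R u := c.R u ∪ Finset.univ.filter fun v => ∃ w, G.Adj u w ∧ x w = some v
  S u := c.S u ∪ (x u).toFinset
  cnt u v := c.cnt u v + (Finset.univ.filter fun w => G.Adj u w ∧ x w = some v).card
  Bhat u := c.Bhat u \ (x u).toFinset
  Prob := c.Prob

/-- The law of a message popped from the buffer `B` according to `P`: the message `m ∈ B` has
probability `P m / ∑ m' ∈ B, P m'`, so the probabilities of messages of the phase that were already
sent are nullified and the normalization is updated. Nothing is popped from an empty buffer. -/
noncomputable def popDist (B : Finset V) (P : V → ℝ≥0∞) : PMF (Option V) :=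
  open Classical in
  if h : (∑ m ∈ B, P m) ≠ 0 ∧ (∑ m ∈ B, P m) ≠ ∞ then
    (PMF.ofFinset (fun m => if m ∈ B then P m / ∑ m' ∈ B, P m' else 0) B
      (by
        rw [Finset.sum_congr rfl fun m hm => if_pos hm]
        simp only [div_eq_mul_inv]
        rw [← Finset.sum_mul, ENNReal.mul_inv_cancel h.1 h.2])
      (fun _ hm => if_neg hm)).map some
  else PMF.pure none

/-- The joint law of independent choices with laws `p u`, `u : V`. -/
noncomputable def independent {A : Type*} [Fintype A] (p : V → PMF A) : PMF (V → A) :=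
  PMF.ofFintype (fun x => ∏ u, p u (x u)) (by
    have h : ∀ u, ∑ a, p u a = 1 := fun u => by
      rw [← tsum_fintype (L := .unconditional A)]; exact (p u).tsum_coe
    have := Finset.prod_univ_sum (fun _ : V => (Finset.univ : Finset A)) (fun u a => p u a)
    rw [Fintype.piFinset_univ] at this
    rw [← this]
    simp [h])

/-- A random round of a phase: independently, every node pops a message from its buffer according to
its probability space and sends it. -/
noncomputable def phaseRound (G : SimpleGraph V) (c : Config V) : PMF (Config V) :=
  (independent fun u => popDist (c.Bhat u) (c.Prob u)).map (c.syncRound G)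

/-- `N` consecutive rounds of a phase. -/
noncomputable def phaseRounds (G : SimpleGraph V) : ℕ → Config V → PMF (Config V)
  | 0, c => PMF.pure c
  | N + 1, c => (phaseRound G c).bind (phaseRounds G N)

/-- `B u`: the messages known to `u` and not yet sent by `u`. -/
def Config.B (c : Config V) (u : V) : Finset V := c.R u \ c.S u

/-- Start of the random phase: the probability space is uniform on the buffer. -/
noncomputable def Config.startRandom (c : Config V) : Config V :=
  { c with
    Bhat := c.B
    Prob := fun u m => if m ∈ c.B u then ((c.B u).card : ℝ≥0∞)⁻¹ else 0 }

/-- The position (starting from `1`) of `m` in the list `B` sorted increasingly by `cnt`, where ties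
are broken according to `tie`. -/
def rank (B : Finset V) (cnt : V → ℕ) (tie : V ↪ ℕ) (m : V) : ℕ :=
  (B.filter fun m' => cnt m' < cnt m ∨ (cnt m' = cnt m ∧ tie m' ≤ tie m)).card

/-- The ranking function: the message of rank `r` in a buffer of size `b` has probability
`1 / (r * H_b)`, where `H_b` is the `b`-th harmonic number. -/
noncomputable def rankingFunction (B : Finset V) (cnt : V → ℕ) (tie : V ↪ ℕ) (m : V) : ℝ≥0∞ :=
  if m ∈ B then ENNReal.ofReal (1 / ((rank B cnt tie m : ℝ) * (harmonic B.card : ℝ))) else 0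

/-- Start of a ranking phase. -/
noncomputable def Config.startRanking (tie : V → V ↪ ℕ) (c : Config V) : Config V :=
  { c with
    Bhat := c.B
    Prob := fun u => rankingFunction (c.B u) (c.cnt u) (tie u) }

/-- The law of the configuration at the end of ranking phase `p` (for `p = 0`: at the end of the
random phase) of the algorithm on `G`, with random phase of length `τ` and ranking phases of length
`τ'`: first every node sends its own message, then the random phase, then ranking phases. The order
in which a node breaks ties at the start of a ranking phase is given by `tie`; it may depend on the
configuration. -/
noncomputable def basicAlgorithm (G : SimpleGraph V) (τ τ' : ℕ) (tie : Config V → V → V ↪ ℕ) :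
    ℕ → PMF (Config V)
  | 0 => phaseRounds G τ ((Config.init.syncRound G fun u => some u).startRandom)
  | p + 1 => (basicAlgorithm G τ τ' tie p).bind fun c =>
      phaseRounds G τ' (c.startRanking (tie c))

/-- Full information spreading: every node knows the message of every node. -/
def Config.FullSpreading (c : Config V) : Prop := ∀ u v, v ∈ c.R u

end Algorithm

/-- The length `τ = α log n` of the random phase (logarithms are to base `2`). -/
noncomputable def randomPhaseLength (α : ℝ) (n : ℕ) : ℕ := ⌈α * Real.logb 2 n⌉₊

/-- The length `τ' = 8 d τ log² n` of a ranking phase. -/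
noncomputable def rankingPhaseLength (α d : ℝ) (n : ℕ) : ℕ :=
  ⌈8 * d * (randomPhaseLength α n : ℝ) * Real.logb 2 n ^ 2⌉₊

/-- The graph `G_{n,k}` (for `k ∣ n`): `n / k` cliques of size `k` in a row, with a perfect matching
between every two consecutive cliques; `(i, a)` is the node of clique `i` in layer `a`. -/
def graphNK (n k : ℕ) : SimpleGraph (Fin (n / k) × Fin k) :=
  SimpleGraph.boxProd (SimpleGraph.pathGraph (n / k)) (⊤ : SimpleGraph (Fin k))

end VertexCongest

open VertexCongest

/-!
During the random phase every message is sent by at least three nodes of its own clique, while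
messages of an adjacent clique reach a node `u` only from its matched neighbour, which sends at most
one message per round, or along the matching edge of another node of the clique of `u`, which picks
that particular message with probability `O(1/k)` per round; so `u` knows only `O(τ)` of them.

From then on the following invariant is kept. After `p` ranking phases, a message of a clique at
distance at most `p` is known to `u` and, unless `u` has sent it, has been received at least three
times; a message of a clique at distance `p + 1` has been received at most twice, namely from the
neighbour of `u` in the next clique and from the node of the clique of `u` in the layer of the
message. Only `O(τ)` known messages belong to cliques at distance `p + 1`, and at most two come from
farther away. Hence an unsent message at distance `p + 1` has rank `O(τ)`, is popped with
probability at least `1 / O(τ log n)` in each round, and is sent within the phase of `Θ(τ log² n)`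
rounds with high probability. If all of them are sent, the invariant holds for `p + 1`, because at
least three nodes of each clique know the message and it crosses exactly one more matching.

Since the nodes pop independently, the probabilities of the bad events are bounded by Markov's
inequality for a product over the nodes of functions of their buffers, whose expectation changes by
at most a fixed factor in every round.
-/

namespace VertexCongest

open scoped Finset

/-! ### Discrete probability -/

section Expectation

variable {α β : Type*}

/-- The expectation of a function with values in `[0, ∞]` under a discrete probability law, as a
plain sum, so that no measurable structure on the sample space has to be chosen. -/
noncomputable def expect (p : PMF α) (f : α → ℝ≥0∞) : ℝ≥0∞ := ∑' a, p a * f a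

lemma expect_pure (a : α) (f : α → ℝ≥0∞) : expect (PMF.pure a) f = f a := by
  simp [expect, PMF.pure_apply, ite_mul]

lemma expect_bind (p : PMF α) (q : α → PMF β) (f : β → ℝ≥0∞) :
    expect (p.bind q) f = expect p fun a => expect (q a) f := by
  simp only [expect, PMF.bind_apply, ← ENNReal.tsum_mul_right, ← ENNReal.tsum_mul_left]
  rw [ENNReal.tsum_comm]
  simp only [mul_assoc]

lemma expect_map (p : PMF α) (g : α → β) (f : β → ℝ≥0∞) :
    expect (p.map g) f = expect p fun a => f (g a) := by
  simp only [PMF.map, expect_bind, Function.comp_apply, expect_pure]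

lemma expect_mono {p : PMF α} {f g : α → ℝ≥0∞} (h : ∀ a ∈ p.support, f a ≤ g a) :
    expect p f ≤ expect p g := by
  refine ENNReal.tsum_le_tsum fun a => ?_
  by_cases ha : p a = 0
  · simp [ha]
  · gcongr
    exact h a ((p.mem_support_iff a).2 ha)

lemma expect_const (p : PMF α) (x : ℝ≥0∞) : expect p (fun _ => x) = x := by
  simp [expect, ENNReal.tsum_mul_right, p.tsum_coe]

lemma expect_const_mul (p : PMF α) (x : ℝ≥0∞) (f : α → ℝ≥0∞) :
    expect p (fun a => x * f a) = x * expect p f := by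
  simp only [expect, ← ENNReal.tsum_mul_left, mul_left_comm]

lemma expect_add (p : PMF α) (f g : α → ℝ≥0∞) :
    expect p (fun a => f a + g a) = expect p f + expect p g := by
  simp only [expect, mul_add, ENNReal.tsum_add]

lemma toOuterMeasure_eq_expect (p : PMF α) (s : Set α) :
    p.toOuterMeasure s = expect p (s.indicator 1) := by
  simp only [PMF.toOuterMeasure_apply, expect, ← Set.indicator_mul_right, Pi.one_apply, mul_one]

lemma toOuterMeasure_add_compl (p : PMF α) (s : Set α) :
    p.toOuterMeasure s + p.toOuterMeasure sᶜ = 1 := by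
  let _ : MeasurableSpace α := ⊤
  simpa only [PMF.toMeasure_apply_eq_toOuterMeasure] using
    MeasureTheory.prob_add_prob_compl (μ := p.toMeasure) (s := s) trivial

lemma one_sub_le_toReal_toOuterMeasure {p : PMF α} {s : Set α} {x : ℝ} (hx : 0 ≤ x)
    (h : p.toOuterMeasure sᶜ ≤ ENNReal.ofReal x) : 1 - x ≤ (p.toOuterMeasure s).toReal := by
  have hs : p.toOuterMeasure s ≠ ∞ :=
    ne_top_of_le_ne_top ENNReal.one_ne_top (le_self_add.trans (toOuterMeasure_add_compl p s).le)
  have htotal : ENNReal.ofReal 1 ≤ ENNReal.ofReal ((p.toOuterMeasure s).toReal + x) := by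
    rw [ENNReal.ofReal_add ENNReal.toReal_nonneg hx, ENNReal.ofReal_toReal hs, ENNReal.ofReal_one,
      ← toOuterMeasure_add_compl p s]
    gcongr
  linarith [(ENNReal.ofReal_le_ofReal_iff (by positivity)).1 htotal]

lemma toOuterMeasure_exists_mem_le {ι : Type*} (p : PMF α) (s : Finset ι) (A : ι → α → Prop)
    {ε : ℝ≥0∞} (hA : ∀ i ∈ s, p.toOuterMeasure {a | A i a} ≤ ε) :
    p.toOuterMeasure {a | ∃ i ∈ s, A i a} ≤ #s * ε :=
  calc p.toOuterMeasure {a | ∃ i ∈ s, A i a}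
    _ = p.toOuterMeasure (⋃ i ∈ s, {a | A i a}) := by congr 1; ext; simp
    _ ≤ ∑ i ∈ s, p.toOuterMeasure {a | A i a} := MeasureTheory.measure_biUnion_finset_le _ _
    _ ≤ #s * ε := (Finset.sum_le_card_nsmul _ _ _ hA).trans_eq (nsmul_eq_mul _ _)

lemma toOuterMeasure_bind_le (p : PMF α) (q : α → PMF β) (good : Set α) (s : Set β)
    {ε : ℝ≥0∞} (h : ∀ a ∈ good, (q a).toOuterMeasure s ≤ ε) :
    (p.bind q).toOuterMeasure s ≤ p.toOuterMeasure goodᶜ + ε := by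
  calc (p.bind q).toOuterMeasure s
    _ = expect p fun a => (q a).toOuterMeasure s := PMF.toOuterMeasure_bind_apply p q s
    _ ≤ expect p fun a => goodᶜ.indicator 1 a + ε := expect_mono fun a _ => by
        by_cases ha : a ∈ good
        · exact (h a ha).trans le_add_self
        · rw [Set.indicator_of_mem (Set.mem_compl ha), Pi.one_apply,
            ← toOuterMeasure_add_compl (q a) s]
          exact le_self_add.trans le_self_add
    _ = p.toOuterMeasure goodᶜ + ε := by
        rw [expect_add, expect_const, toOuterMeasure_eq_expect]

variable {V A : Type*} [Fintype V] [DecidableEq V] [Fintype A]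

lemma expect_independent_prod (p : V → PMF A) (W : Finset V) (g : V → A → ℝ≥0∞) :
    expect (independent p) (fun x => ∏ u ∈ W, g u (x u)) = ∏ u ∈ W, expect (p u) (g u) := by
  have prod_univ (g : V → A → ℝ≥0∞) :
      expect (independent p) (fun x => ∏ u, g u (x u)) = ∏ u, expect (p u) (g u) := by
    classical
    simp only [expect, tsum_fintype, independent, PMF.ofFintype_apply, Finset.prod_univ_sum,
      Fintype.piFinset_univ, Finset.prod_mul_distrib]
  convert prod_univ fun u a => if u ∈ W then g u a else 1 using 1
  · simp
  · rw [← Finset.univ_inter W, ← Finset.prod_ite_mem]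
    refine Finset.prod_congr rfl fun u _ => ?_
    by_cases hu : u ∈ W <;> simp [hu, expect_const]

lemma mem_support_of_mem_support_independent {p : V → PMF A} {x : V → A}
    (hx : x ∈ (independent p).support) (u : V) : x u ∈ (p u).support := by
  rw [PMF.mem_support_iff, independent, PMF.ofFintype_apply, Finset.prod_ne_zero_iff] at hx
  exact (PMF.mem_support_iff _ _).2 (hx u (Finset.mem_univ u))

end Expectation

section PopDist

variable {V : Type*} [DecidableEq V] {B : Finset V} {P : V → ℝ≥0∞} {m : V}

lemma popDist_some (h0 : ∑ m ∈ B, P m ≠ 0) (htop : ∑ m ∈ B, P m ≠ ∞) (hm : m ∈ B) :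
    popDist B P (some m) = P m / ∑ m' ∈ B, P m' := by
  classical
  rw [popDist, dif_pos ⟨h0, htop⟩, PMF.map_apply, tsum_eq_single m]
  · simp [PMF.ofFinset_apply, hm]
  · intro b hb
    simp [hb.symm]

lemma mem_of_some_mem_support_popDist (h : some m ∈ (popDist B P).support) : m ∈ B := by
  classical
  unfold popDist at h
  split_ifs at h
  · obtain ⟨a, ha, hm⟩ := (PMF.mem_support_map_iff _ _ _).1 h
    obtain rfl := Option.some_injective _ hm
    by_contra hB
    exact (PMF.mem_support_iff _ _).1 ha (if_neg hB)
  · simp at h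

lemma popDist_some_of_forall_eq {x : ℝ≥0∞} (h0 : x ≠ 0) (htop : x ≠ ∞) (hP : ∀ m ∈ B, P m = x)
    (hm : m ∈ B) : popDist B P (some m) = (#B : ℝ≥0∞)⁻¹ := by
  have hsum : ∑ m ∈ B, P m = #B * x := by rw [Finset.sum_congr rfl hP]; simp
  have hB : (#B : ℝ≥0∞) ≠ 0 := by simpa using Finset.ne_empty_of_mem hm
  rw [popDist_some _ _ hm, hsum, hP m hm]
  · rw [ENNReal.div_eq_inv_mul, ENNReal.mul_inv (Or.inl hB) (Or.inr h0), mul_assoc,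
      ENNReal.inv_mul_cancel h0 htop, mul_one]
  · exact hsum ▸ mul_ne_zero hB h0
  · exact hsum ▸ ENNReal.mul_ne_top (ENNReal.natCast_ne_top _) htop

lemma le_popDist_some (hsum : ∑ m ∈ B, P m ≤ 1) (hm : m ∈ B) : P m ≤ popDist B P (some m) := by
  rcases eq_or_ne (P m) 0 with hPm | hPm
  · simp [hPm]
  have h0 : ∑ m ∈ B, P m ≠ 0 := fun h => hPm (Finset.sum_eq_zero_iff.1 h m hm)
  calc P m = P m / 1 := (div_one _).symm
    _ ≤ P m / ∑ m' ∈ B, P m' := ENNReal.div_le_div_left hsum _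
    _ = popDist B P (some m) :=
      (popDist_some h0 (ne_top_of_le_ne_top ENNReal.one_ne_top hsum) hm).symm

lemma expect_ite_mem_sdiff_toFinset_zero (p : PMF (Option V)) (hm : m ∈ B) :
    expect p (fun x => if m ∈ B \ x.toFinset then 1 else 0) = 1 - p (some m) := by
  have hfun : (fun x : Option V => if m ∈ B \ x.toFinset then (1 : ℝ≥0∞) else 0) =
      ({some m}ᶜ : Set (Option V)).indicator 1 := by
    ext x
    simp [hm, Set.indicator_apply]
  rw [hfun, ← toOuterMeasure_eq_expect]
  refine ENNReal.eq_sub_of_add_eq (p.apply_ne_top _) ?_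
  rw [← PMF.toOuterMeasure_apply_singleton p, add_comm, toOuterMeasure_add_compl]

lemma expect_ite_mem_sdiff_toFinset_two (p : PMF (Option V)) (hm : m ∈ B) :
    expect p (fun x => if m ∈ B \ x.toFinset then 1 else 2) = 1 + p (some m) := by
  have hfun : (fun x : Option V => if m ∈ B \ x.toFinset then (1 : ℝ≥0∞) else 2) =
      fun x => 1 + ({some m} : Set (Option V)).indicator 1 x := by
    ext x
    by_cases hx : x = some m <;> simp [hm, hx, one_add_one_eq_two]
  rw [hfun, expect_add, expect_const, ← toOuterMeasure_eq_expect,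
    PMF.toOuterMeasure_apply_singleton]

end PopDist

section Ranking

variable {V : Type*} {B : Finset V} {cnt : V → ℕ} {tie : V ↪ ℕ} {m m' : V}

lemma rank_pos (hm : m ∈ B) : 0 < rank B cnt tie m :=
  Finset.card_pos.2 ⟨m, by simp [hm]⟩

lemma rank_lt_rank (hm' : m' ∈ B) (h : cnt m < cnt m' ∨ (cnt m = cnt m' ∧ tie m < tie m')) :
    rank B cnt tie m < rank B cnt tie m' := by
  refine Finset.card_lt_card ⟨fun x hx => ?_, fun hsub => ?_⟩
  · simp only [Finset.mem_filter] at hx ⊢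
    exact ⟨hx.1, by omega⟩
  · have := hsub (show m' ∈ _ by simp [hm'])
    simp only [Finset.mem_filter] at this
    omega

variable (B cnt tie)

lemma rank_injOn : Set.InjOn (rank B cnt tie) B := by
  intro m hm m' hm' h
  by_contra hne
  have htie : tie m ≠ tie m' := tie.injective.ne hne
  by_cases hlt : cnt m < cnt m' ∨ (cnt m = cnt m' ∧ tie m < tie m')
  · exact (rank_lt_rank hm' hlt).ne h
  · exact (rank_lt_rank hm (by omega)).ne' h

lemma sum_inv_rank_le_harmonic : ∑ m ∈ B, (rank B cnt tie m : ℝ)⁻¹ ≤ harmonic #B := by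
  rw [← Finset.sum_image (f := fun r : ℕ => (r : ℝ)⁻¹) (rank_injOn B cnt tie), harmonic_eq_sum_Icc]
  push_cast
  refine Finset.sum_le_sum_of_subset_of_nonneg ?_ fun _ _ _ => by positivity
  intro r hr
  obtain ⟨m, hm, rfl⟩ := Finset.mem_image.1 hr
  exact Finset.mem_Icc.2 ⟨rank_pos hm, Finset.card_filter_le _ _⟩

lemma harmonic_mono : Monotone harmonic :=
  monotone_nat_of_le_succ fun n => by
    rw [harmonic_succ]
    exact le_add_of_nonneg_right (by positivity)

lemma harmonic_nonneg (n : ℕ) : 0 ≤ harmonic n := harmonic_zero ▸ harmonic_mono n.zero_le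

variable [DecidableEq V]

lemma sum_rankingFunction_le_one : ∑ m ∈ B, rankingFunction B cnt tie m ≤ 1 := by
  have hH : (0 : ℝ) ≤ harmonic #B := by exact_mod_cast harmonic_nonneg #B
  rw [Finset.sum_congr rfl fun m hm => by rw [rankingFunction, if_pos hm],
    ← ENNReal.ofReal_sum_of_nonneg fun m _ => by positivity, ← ENNReal.ofReal_one]
  refine ENNReal.ofReal_le_ofReal ?_
  simp only [← div_div, one_div]
  rw [← Finset.sum_div]
  exact div_le_one_of_le₀ (sum_inv_rank_le_harmonic B cnt tie) hH

variable {B cnt tie}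

lemma le_rankingFunction {r b : ℕ} (hm : m ∈ B) (hr : rank B cnt tie m ≤ r) (hb : #B ≤ b) :
    ENNReal.ofReal (1 / (r * harmonic b)) ≤ rankingFunction B cnt tie m := by
  have hH : (0 : ℝ) < harmonic #B := by exact_mod_cast harmonic_pos (Finset.card_ne_zero_of_mem hm)
  have hrank : (0 : ℝ) < rank B cnt tie m := by exact_mod_cast rank_pos hm
  rw [rankingFunction, if_pos hm]
  gcongr
  exact_mod_cast harmonic_mono hb

end Ranking

/-! ### Phases on an arbitrary graph -/

lemma Config.mem_B {V : Type*} [DecidableEq V] {c : Config V} {u v : V} :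
    v ∈ c.B u ↔ v ∈ c.R u ∧ v ∉ c.S u :=
  Finset.mem_sdiff

section Phases

variable {V : Type*} [Fintype V] [DecidableEq V] {G : SimpleGraph V} {c c₀ c' : Config V} {j N : ℕ}

open Classical in
/-- The invariant of an execution on `G`: the knowledge and the counters of a configuration are
determined by the sets of sent messages, as no node sends a message twice. -/
structure Config.Valid (G : SimpleGraph V) (c : Config V) : Prop where
  mem_R : ∀ u v, v ∈ c.R u ↔ v = u ∨ ∃ w, G.Adj u w ∧ v ∈ c.S w
  cnt_eq : ∀ u v, c.cnt u v = (if v = u then 1 else 0) + #{w | G.Adj u w ∧ v ∈ c.S w}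
  S_subset : ∀ u, c.S u ⊆ c.R u

namespace Config

lemma valid_init : (init : Config V).Valid G where
  mem_R u v := by simp [init]
  cnt_eq u v := by simp [init]
  S_subset u := by simp [init]

namespace Valid

lemma syncRound (hc : c.Valid G) {x : V → Option V} (hx : ∀ u v, x u = some v → v ∈ c.B u) :
    (c.syncRound G x).Valid G where
  mem_R u v := by
    simp only [Config.syncRound, Finset.mem_union, hc.mem_R, Finset.mem_filter, Finset.mem_univ,
      true_and, Option.mem_toFinset, Option.mem_def, and_or_left, exists_or, or_assoc]
  cnt_eq u v := by
    classical
    simp only [Config.syncRound, hc.cnt_eq, Finset.mem_union, Option.mem_toFinset, Option.mem_def,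
      and_or_left, add_assoc]
    rw [Finset.filter_or, Finset.card_union_of_disjoint]
    rw [Finset.disjoint_filter]
    rintro w - ⟨-, hsent⟩ ⟨-, hnew⟩
    exact (mem_B.1 (hx w v hnew)).2 hsent
  S_subset u := by
    refine Finset.union_subset ((hc.S_subset u).trans Finset.subset_union_left) fun v hv => ?_
    exact Finset.mem_union_left _ (mem_B.1 (hx u v (by simpa using hv))).1

lemma mem_R_of_adj (hc : c.Valid G) {u v w : V} (hw : G.Adj u w) (hv : v ∈ c.S w) : v ∈ c.R u :=
  (hc.mem_R u v).2 (Or.inr ⟨w, hw, hv⟩)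

lemma R_mono (hc : c.Valid G) (hc' : c'.Valid G) (hS : ∀ u, c.S u ⊆ c'.S u) (u : V) :
    c.R u ⊆ c'.R u := fun v hv =>
  (hc'.mem_R u v).2 <| ((hc.mem_R u v).1 hv).imp_right fun ⟨w, hw, hv⟩ => ⟨w, hw, hS w hv⟩

lemma cnt_mono (hc : c.Valid G) (hc' : c'.Valid G) (hS : ∀ u, c.S u ⊆ c'.S u) (u v : V) :
    c.cnt u v ≤ c'.cnt u v := by
  classical
  rw [hc.cnt_eq, hc'.cnt_eq]
  gcongr with w
  exact hS w

lemma card_le_cnt (hc : c.Valid G) {u v : V} {s : Finset V}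
    (hs : ∀ w ∈ s, G.Adj u w ∧ v ∈ c.S w) : #s ≤ c.cnt u v := by
  classical
  rw [hc.cnt_eq]
  exact le_add_left (Finset.card_le_card fun w hw => by simpa using hs w hw)

end Valid

/-- A configuration in which a phase starts: the buffers of the phase have just been set to the
known messages not yet sent. -/
structure PhaseStart (G : SimpleGraph V) (c : Config V) : Prop extends c.Valid G where
  Bhat_eq : c.Bhat = c.B

lemma Valid.startRandom (hc : c.Valid G) : c.startRandom.PhaseStart G :=
  ⟨⟨hc.mem_R, hc.cnt_eq, hc.S_subset⟩, rfl⟩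

lemma Valid.startRanking (hc : c.Valid G) (tie : V → V ↪ ℕ) :
    (c.startRanking tie).PhaseStart G :=
  ⟨⟨hc.mem_R, hc.cnt_eq, hc.S_subset⟩, rfl⟩

end Config

/-- The properties of a configuration `c` reached `j` rounds after the start `c₀` of a phase. -/
structure InPhase (G : SimpleGraph V) (c₀ : Config V) (j : ℕ) (c : Config V) : Prop where
  valid : c.Valid G
  Bhat_eq : ∀ u, c.Bhat u = c₀.B u \ c.S u
  Prob_eq : c.Prob = c₀.Prob
  S_mono : ∀ u, c₀.S u ⊆ c.S u
  S_subset : ∀ u, c.S u ⊆ c₀.R u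
  card_S_le : ∀ u, #(c.S u) ≤ #(c₀.S u) + j
  t_eq : c.t = c₀.t + j

namespace InPhase

lemma start (hc : c.PhaseStart G) : InPhase G c 0 c where
  valid := hc.toValid
  Bhat_eq u := by simp [hc.Bhat_eq, Config.B]
  Prob_eq := rfl
  S_mono _ := subset_rfl
  S_subset := hc.S_subset
  card_S_le _ := le_rfl
  t_eq := rfl

lemma Bhat_subset_B_start (h : InPhase G c₀ j c) (u : V) : c.Bhat u ⊆ c₀.B u :=
  h.Bhat_eq u ▸ Finset.sdiff_subset

lemma mem_Bhat_iff (h : InPhase G c₀ j c) {u v : V} (hv : v ∈ c₀.B u) :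
    v ∈ c.Bhat u ↔ v ∉ c.S u := by
  simp [h.Bhat_eq, hv]

lemma syncRound (h : InPhase G c₀ j c) (hc₀ : c₀.Valid G) {x : V → Option V}
    (hx : ∀ u v, x u = some v → v ∈ c.Bhat u) : InPhase G c₀ (j + 1) (c.syncRound G x) where
  valid := h.valid.syncRound fun u v hv => by
    have hB := h.Bhat_subset_B_start u (hx u v hv)
    exact Config.mem_B.2 ⟨hc₀.R_mono h.valid h.S_mono u (Config.mem_B.1 hB).1,
      (h.mem_Bhat_iff hB).1 (hx u v hv)⟩
  Bhat_eq u := by simp only [Config.syncRound, h.Bhat_eq, sdiff_sdiff_left, Finset.sup_eq_union]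
  Prob_eq := h.Prob_eq
  S_mono u := (h.S_mono u).trans Finset.subset_union_left
  S_subset u := Finset.union_subset (h.S_subset u) fun v hv =>
    (Config.mem_B.1 (h.Bhat_subset_B_start u (hx u v (by simpa using hv)))).1
  card_S_le u := by
    have hx : #(x u).toFinset ≤ 1 := by cases x u <;> simp
    have hunion := Finset.card_union_le (c.S u) (x u).toFinset
    have := h.card_S_le u
    simp only [Config.syncRound]
    omega
  t_eq := by simp [Config.syncRound, h.t_eq, add_assoc]

lemma of_mem_support_phaseRound (h : InPhase G c₀ j c) (hc₀ : c₀.Valid G)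
    (hc' : c' ∈ (phaseRound G c).support) : InPhase G c₀ (j + 1) c' := by
  obtain ⟨x, hx, rfl⟩ := (PMF.mem_support_map_iff _ _ _).1 hc'
  exact h.syncRound hc₀ fun u v huv =>
    mem_of_some_mem_support_popDist (huv ▸ mem_support_of_mem_support_independent hx u)

end InPhase

lemma phaseRounds_succ (G : SimpleGraph V) (N : ℕ) (c : Config V) :
    phaseRounds G (N + 1) c = (phaseRounds G N c).bind (phaseRound G) := by
  induction N generalizing c with
  | zero => simp only [phaseRounds, PMF.pure_bind, PMF.bind_pure]
  | succ N ih => exact (congrArg _ (funext ih)).trans (PMF.bind_bind _ _ _).symm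

lemma InPhase.of_mem_support_phaseRounds (hc₀ : c₀.PhaseStart G)
    (hc : c ∈ (phaseRounds G N c₀).support) : InPhase G c₀ N c := by
  induction N generalizing c with
  | zero =>
    rw [phaseRounds, PMF.mem_support_pure_iff] at hc
    subst hc
    exact .start hc₀
  | succ N ih =>
    rw [phaseRounds_succ, PMF.mem_support_bind_iff] at hc
    obtain ⟨d, hd, hc⟩ := hc
    exact (ih hd).of_mem_support_phaseRound hc₀.toValid hc

lemma expect_phaseRound_prod (c : Config V) (W : Finset V) (φ : V → Finset V → ℝ≥0∞) :
    expect (phaseRound G c) (fun c' => ∏ u ∈ W, φ u (c'.Bhat u)) =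
      ∏ u ∈ W, expect (popDist (c.Bhat u) (c.Prob u)) fun x =>
        φ u (c.Bhat u \ x.toFinset) := by
  rw [phaseRound, expect_map]
  exact expect_independent_prod _ W fun u x => φ u (c.Bhat u \ Option.toFinset x)

lemma expect_phaseRounds_prod_le (hc₀ : c₀.PhaseStart G) (W : Finset V) (φ : V → Finset V → ℝ≥0∞)
    (r : ℝ≥0∞) (hr : ∀ j < N, ∀ c, InPhase G c₀ j c → ∀ u ∈ W,
      expect (popDist (c.Bhat u) (c.Prob u)) (fun x => φ u (c.Bhat u \ x.toFinset)) ≤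
        r * φ u (c.Bhat u)) :
    expect (phaseRounds G N c₀) (fun c => ∏ u ∈ W, φ u (c.Bhat u)) ≤
      r ^ (#W * N) * ∏ u ∈ W, φ u (c₀.B u) := by
  induction N with
  | zero => simp [phaseRounds, expect_pure, hc₀.Bhat_eq]
  | succ N ih =>
    calc expect (phaseRounds G (N + 1) c₀) (fun c => ∏ u ∈ W, φ u (c.Bhat u))
      _ = expect (phaseRounds G N c₀) fun c => ∏ u ∈ W,
            expect (popDist (c.Bhat u) (c.Prob u)) fun x => φ u (c.Bhat u \ x.toFinset) := by
          simp only [phaseRounds_succ, expect_bind, expect_phaseRound_prod]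
      _ ≤ expect (phaseRounds G N c₀) fun c => r ^ #W * ∏ u ∈ W, φ u (c.Bhat u) := by
          refine expect_mono fun c hc => ?_
          rw [← Finset.prod_const, ← Finset.prod_mul_distrib]
          exact Finset.prod_le_prod' fun u hu =>
            hr N N.lt_succ_self c (.of_mem_support_phaseRounds hc₀ hc) u hu
      _ ≤ r ^ #W * (r ^ (#W * N) * ∏ u ∈ W, φ u (c₀.B u)) := by
          rw [expect_const_mul]
          gcongr
          exact ih fun j hj => hr j (hj.trans N.lt_succ_self)
      _ = r ^ (#W * (N + 1)) * ∏ u ∈ W, φ u (c₀.B u) := by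
          rw [← mul_assoc, ← pow_add, mul_add_one, add_comm]

lemma ofReal_exp_pow (x : ℝ) (n : ℕ) :
    ENNReal.ofReal (Real.exp x) ^ n = ENNReal.ofReal (Real.exp (n * x)) := by
  rw [← ENNReal.ofReal_pow (Real.exp_pos x).le, Real.exp_nat_mul]

lemma phaseRounds_keep_le (hc₀ : c₀.PhaseStart G) (N : ℕ) (W : Finset V) (f : V → V)
    (hf : ∀ u ∈ W, f u ∈ c₀.B u) {ε : ℝ}
    (hε : ∀ j < N, ∀ c, InPhase G c₀ j c → ∀ u ∈ W, f u ∈ c.Bhat u →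
      ENNReal.ofReal ε ≤ popDist (c.Bhat u) (c.Prob u) (some (f u))) :
    (phaseRounds G N c₀).toOuterMeasure {c | ∀ u ∈ W, f u ∉ c.S u} ≤
      ENNReal.ofReal (Real.exp (-(ε * #W * N))) := by
  let φ (u : V) (B : Finset V) : ℝ≥0∞ := if f u ∈ B then 1 else 0
  have hround : 1 - ENNReal.ofReal ε ≤ ENNReal.ofReal (Real.exp (-ε)) := by
    rw [tsub_le_iff_right, ← ENNReal.ofReal_one]
    refine (ENNReal.ofReal_le_ofReal ?_).trans ENNReal.ofReal_add_le
    linarith [Real.one_sub_le_exp_neg ε]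
  calc (phaseRounds G N c₀).toOuterMeasure {c | ∀ u ∈ W, f u ∉ c.S u}
    _ ≤ expect (phaseRounds G N c₀) (fun c => ∏ u ∈ W, φ u (c.Bhat u)) := by
        rw [toOuterMeasure_eq_expect]
        refine expect_mono fun c hc => ?_
        by_cases hkeep : ∀ u ∈ W, f u ∉ c.S u
        · have hφ : ∀ u ∈ W, φ u (c.Bhat u) = 1 := fun u hu => if_pos <|
            ((InPhase.of_mem_support_phaseRounds hc₀ hc).mem_Bhat_iff (hf u hu)).2 (hkeep u hu)
          rw [Finset.prod_eq_one hφ]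
          exact (Set.indicator_of_mem (s := {c : Config V | ∀ u ∈ W, f u ∉ c.S u}) hkeep 1).le
        · simp [hkeep]
    _ ≤ ENNReal.ofReal (Real.exp (-ε)) ^ (#W * N) * ∏ u ∈ W, φ u (c₀.B u) := by
        refine expect_phaseRounds_prod_le hc₀ W φ _ fun j hj c hc u hu => ?_
        by_cases hm : f u ∈ c.Bhat u
        · simp only [φ, hm, if_true, mul_one, expect_ite_mem_sdiff_toFinset_zero _ hm]
          exact (tsub_le_tsub_left (hε j hj c hc u hu hm) 1).trans hround
        · simp [φ, hm, expect_const]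
    _ = ENNReal.ofReal (Real.exp (-(ε * #W * N))) := by
        rw [Finset.prod_eq_one fun u hu => if_pos (hf u hu), mul_one, ofReal_exp_pow]
        push_cast
        ring_nf

lemma phaseRounds_many_le (hc₀ : c₀.PhaseStart G) (N : ℕ) (W : Finset V) (f : V → V)
    (hf : ∀ u ∈ W, f u ∈ c₀.B u) {q : ℝ} (hq₀ : 0 ≤ q)
    (hq : ∀ j < N, ∀ c, InPhase G c₀ j c → ∀ u ∈ W, f u ∈ c.Bhat u →
      popDist (c.Bhat u) (c.Prob u) (some (f u)) ≤ ENNReal.ofReal q) (K : ℕ) :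
    (phaseRounds G N c₀).toOuterMeasure {c | K ≤ #{u ∈ W | f u ∈ c.S u}} ≤
      ENNReal.ofReal (Real.exp (q * #W * N)) / 2 ^ K := by
  let φ (u : V) (B : Finset V) : ℝ≥0∞ := if f u ∈ B then 1 else 2
  have hround : 1 + ENNReal.ofReal q ≤ ENNReal.ofReal (Real.exp q) := by
    rw [← ENNReal.ofReal_one, ← ENNReal.ofReal_add zero_le_one hq₀]
    exact ENNReal.ofReal_le_ofReal (by linarith [Real.add_one_le_exp q])
  rw [ENNReal.le_div_iff_mul_le (by simp) (by simp), mul_comm]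
  calc 2 ^ K * (phaseRounds G N c₀).toOuterMeasure {c | K ≤ #{u ∈ W | f u ∈ c.S u}}
    _ ≤ expect (phaseRounds G N c₀) (fun c => ∏ u ∈ W, φ u (c.Bhat u)) := by
        rw [toOuterMeasure_eq_expect, ← expect_const_mul]
        refine expect_mono fun c hc => ?_
        by_cases hK : K ≤ #{u ∈ W | f u ∈ c.S u}
        · have hφ : ∀ u ∈ W, φ u (c.Bhat u) = if f u ∈ c.S u then 2 else 1 := fun u hu => by
            simp [φ, (InPhase.of_mem_support_phaseRounds hc₀ hc).mem_Bhat_iff (hf u hu)]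
          simpa [hK, Finset.prod_congr rfl hφ, Finset.prod_ite] using
            pow_le_pow_right₀ one_le_two hK
        · simp [hK]
    _ ≤ ENNReal.ofReal (Real.exp q) ^ (#W * N) * ∏ u ∈ W, φ u (c₀.B u) := by
        refine expect_phaseRounds_prod_le hc₀ W φ _ fun j hj c hc u hu => ?_
        by_cases hm : f u ∈ c.Bhat u
        · simp only [φ, hm, if_true, mul_one, expect_ite_mem_sdiff_toFinset_two _ hm]
          exact (add_le_add_right (hq j hj c hc u hu hm) 1).trans hround
        · simpa [φ, hm, expect_const] using
            le_mul_of_one_le_left zero_le (le_self_add.trans hround)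
    _ = ENNReal.ofReal (Real.exp (q * #W * N)) := by
        rw [Finset.prod_eq_one fun u hu => if_pos (hf u hu), mul_one, ofReal_exp_pow]
        push_cast
        ring_nf

/-- The start of the random phase: every node has sent exactly its own message. -/
noncomputable def randomStart (G : SimpleGraph V) : Config V :=
  ((Config.init : Config V).syncRound G fun u => some u).startRandom

lemma randomStart_phaseStart (G : SimpleGraph V) : (randomStart G).PhaseStart G :=
  (Config.valid_init.syncRound fun u v h => by
    obtain rfl : u = v := by simpa using h
    simp [Config.mem_B, Config.init]).startRandom

lemma randomStart_S (u : V) : (randomStart G).S u = {u} := by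
  simp [randomStart, Config.startRandom, Config.syncRound, Config.init]

lemma mem_randomStart_R {u v : V} : v ∈ (randomStart G).R u ↔ v = u ∨ G.Adj u v := by
  rw [(randomStart_phaseStart G).mem_R]
  simp [randomStart_S]

lemma mem_randomStart_B {u v : V} : v ∈ (randomStart G).B u ↔ G.Adj u v := by
  rw [Config.mem_B, mem_randomStart_R, randomStart_S, Finset.mem_singleton]
  exact ⟨fun h => h.1.resolve_left h.2, fun h => ⟨Or.inr h, h.ne'⟩⟩

namespace InPhase

variable (h : InPhase G (randomStart G) j c)
include h

lemma self_mem_S (u : V) : u ∈ c.S u :=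
  h.S_mono u (by rw [randomStart_S, Finset.mem_singleton])

lemma eq_or_adj_of_mem_S {u v : V} (hv : v ∈ c.S u) : v = u ∨ G.Adj u v :=
  mem_randomStart_R.1 (h.S_subset u hv)

lemma card_S_le_one_add (u : V) : #(c.S u) ≤ 1 + j := by
  simpa only [randomStart_S, Finset.card_singleton] using h.card_S_le u

end InPhase

end Phases

section BufferLaws

variable {V : Type*} [Fintype V] [DecidableEq V] {G : SimpleGraph V} {c c₀ : Config V} {j : ℕ}
  {u m : V}

lemma InPhase.popDist_of_startRandom (h : InPhase G c₀.startRandom j c) (hm : m ∈ c.Bhat u) :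
    popDist (c.Bhat u) (c.Prob u) (some m) = (#(c.Bhat u) : ℝ≥0∞)⁻¹ := by
  have hsub : c.Bhat u ⊆ c₀.B u := h.Bhat_subset_B_start u
  have hne : #(c₀.B u) ≠ 0 := Finset.card_ne_zero_of_mem (hsub hm)
  refine popDist_some_of_forall_eq (x := (#(c₀.B u) : ℝ≥0∞)⁻¹) (by simp) (by simpa using hne)
    (fun m hm => ?_) hm
  rw [h.Prob_eq]
  exact if_pos (hsub hm)

lemma InPhase.rankingFunction_le_popDist {tie : V → V ↪ ℕ}
    (h : InPhase G (c₀.startRanking tie) j c) (hm : m ∈ c.Bhat u) :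
    rankingFunction (c₀.B u) (c₀.cnt u) (tie u) m ≤ popDist (c.Bhat u) (c.Prob u) (some m) := by
  rw [h.Prob_eq]
  refine le_popDist_some (P := (c₀.startRanking tie).Prob u) ?_ hm
  exact (Finset.sum_le_sum_of_subset (h.Bhat_subset_B_start u)).trans
    (sum_rankingFunction_le_one (c₀.B u) (c₀.cnt u) (tie u))

end BufferLaws

/-! ### Spreading along a row of cliques -/

lemma two_lt_card_of_forall_exists {ι : Type*} {s : Finset ι} {a : ι} (ha : a ∈ s)
    (h : ∀ b, ∃ x ∈ s, x ≠ a ∧ x ≠ b) : 2 < #s := by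
  obtain ⟨b, hb, hba, -⟩ := h a
  obtain ⟨x, hx, hxa, hxb⟩ := h b
  exact Finset.two_lt_card.2 ⟨a, ha, b, hb, x, hx, hba.symm, hxa.symm, hxb.symm⟩

section CliqueRow

variable {N : ℕ} {κ : Type*}

/-- A row of `N` cliques with nodes indexed by `κ`, equally indexed nodes of consecutive cliques
being matched; for `κ = Fin k` and `N = n / k` this is the graph `graphNK n k`. -/
abbrev cliqueRow (N : ℕ) (κ : Type*) : SimpleGraph (Fin N × κ) :=
  SimpleGraph.boxProd (SimpleGraph.pathGraph N) ⊤

/-- The distance in the row between the cliques of two nodes. -/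
def cliqueDist (u v : Fin N × κ) : ℕ := Nat.dist u.1 v.1

variable {u v w w' : Fin N × κ}

lemma cliqueDist_self (u : Fin N × κ) : cliqueDist u u = 0 := Nat.dist_self _

lemma cliqueDist_eq_zero : cliqueDist u v = 0 ↔ u.1 = v.1 := by
  unfold cliqueDist Nat.dist
  omega

lemma cliqueRow_adj : (cliqueRow N κ).Adj u v ↔
    (u.1 = v.1 ∧ u.2 ≠ v.2) ∨ (u.2 = v.2 ∧ cliqueDist u v = 1) := by
  rw [SimpleGraph.boxProd_adj, SimpleGraph.pathGraph_adj, SimpleGraph.top_adj]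
  unfold cliqueDist Nat.dist
  have : (u.1 : ℕ) + 1 = v.1 ∨ (v.1 : ℕ) + 1 = u.1 ↔
      (u.1 - v.1 + (v.1 - u.1) : ℕ) = 1 := by omega
  tauto

lemma cliqueDist_congr (hu : u.1 = w.1) (hv : v.1 = w'.1) : cliqueDist u v = cliqueDist w w' := by
  rw [cliqueDist, cliqueDist, hu, hv]

lemma cliqueDist_of_adj (h : (cliqueRow N κ).Adj u w) (v : Fin N × κ) :
    (w.1 = u.1 ∧ cliqueDist w v = cliqueDist u v) ∨
      (w.2 = u.2 ∧ cliqueDist u w = 1 ∧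
        (cliqueDist w v = cliqueDist u v + 1 ∨ cliqueDist w v + 1 = cliqueDist u v)) := by
  rcases cliqueRow_adj.1 h with ⟨hfst, -⟩ | ⟨hsnd, hdist⟩
  · exact Or.inl ⟨hfst.symm, cliqueDist_congr hfst.symm rfl⟩
  · refine Or.inr ⟨hsnd.symm, hdist, ?_⟩
    unfold cliqueDist Nat.dist at *
    omega

lemma exists_closer (h : 0 < cliqueDist u v) :
    ∃ w, w.2 = u.2 ∧ cliqueDist u w = 1 ∧ cliqueDist w v + 1 = cliqueDist u v := by
  unfold cliqueDist Nat.dist at *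
  by_cases hlt : (u.1 : ℕ) < v.1
  · exact ⟨(⟨u.1 + 1, by omega⟩, u.2), rfl, by simp only; omega, by simp only; omega⟩
  · exact ⟨(⟨u.1 - 1, by omega⟩, u.2), rfl, by simp only; omega, by simp only; omega⟩

lemma fst_eq_of_closer (hw : cliqueDist u w = 1) (hw' : cliqueDist u w' = 1)
    (h : cliqueDist w v + 1 = cliqueDist u v) (h' : cliqueDist w' v + 1 = cliqueDist u v) :
    w.1 = w'.1 := by
  unfold cliqueDist Nat.dist at *
  omega

lemma card_filter_cliqueDist_le (s : Finset (Fin N × κ)) (u : Fin N × κ) (g : ℕ) {M : ℕ}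
    (hM : ∀ v, cliqueDist u v = g → #{m ∈ s | m.1 = v.1} ≤ M) :
    #{m ∈ s | cliqueDist u m = g} ≤ M * 2 := by
  have hfiber : ∀ i ∈ {m ∈ s | cliqueDist u m = g}.image Prod.fst,
      #{m ∈ {m ∈ s | cliqueDist u m = g} | m.1 = i} ≤ M := by
    simp only [Finset.mem_image, Finset.mem_filter]
    rintro i ⟨v, ⟨-, hv⟩, rfl⟩
    exact (Finset.card_le_card (Finset.filter_subset_filter _ (Finset.filter_subset _ _))).trans
      (hM v hv)
  have himage : #({m ∈ s | cliqueDist u m = g}.image Prod.fst) ≤ 2 := by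
    refine (Finset.card_le_card_of_injOn (t := {(u.1 + g : ℕ), (u.1 - g : ℕ)}) Fin.val
      (fun i hi => ?_) Fin.val_injective.injOn).trans Finset.card_le_two
    obtain ⟨v, hv, rfl⟩ := Finset.mem_image.1 hi
    have hv := (Finset.mem_filter.1 hv).2
    unfold cliqueDist Nat.dist at hv
    simp only [Finset.coe_insert, Finset.coe_singleton, Set.mem_insert_iff, Set.mem_singleton_iff]
    omega
  exact (Finset.card_le_mul_card_image _ M hfiber).trans (Nat.mul_le_mul_left M himage)

variable [Fintype κ] [DecidableEq κ] {c : Config (Fin N × κ)}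

namespace Config.Valid

lemma mem_R_of_clique (hc : c.Valid (cliqueRow N κ)) (huw : u.1 = w.1) (hv : v ∈ c.S w) :
    v ∈ c.R u := by
  by_cases h : u.2 = w.2
  · obtain rfl : u = w := Prod.ext huw h
    exact hc.S_subset u hv
  · exact hc.mem_R_of_adj (cliqueRow_adj.2 (Or.inl ⟨huw, h⟩)) hv

lemma card_senders_le_cnt (hc : c.Valid (cliqueRow N κ)) (hu : v ∉ c.S u) :
    #{a | v ∈ c.S (u.1, a)} ≤ c.cnt u v := by
  rw [← Finset.card_map (Function.Embedding.sectR u.1 κ)]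
  refine hc.card_le_cnt fun w hw => ?_
  obtain ⟨a, ha, rfl⟩ := Finset.mem_map.1 hw
  have ha : v ∈ c.S (u.1, a) := (Finset.mem_filter.1 ha).2
  refine ⟨cliqueRow_adj.2 (Or.inl ⟨rfl, ?_⟩), ha⟩
  rintro rfl
  exact hu ha

end Config.Valid

/-- The state of the information spreading after ranking phase `p`. The messages of cliques at
distance `p + 1` are those that have to be sent in the next phase: `snd_eq` and `notMem_S` limit how
often they have been received, `card_known_le` how many of them compete, and `three_le_card`
provides three nodes of each clique able to send them. -/
structure Spread (M p : ℕ) (c : Config (Fin N × κ)) : Prop extends c.Valid (cliqueRow N κ) where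
  known : ∀ u v, cliqueDist u v ≤ p → v ∈ c.R u
  three_le_cnt : ∀ u v, cliqueDist u v ≤ p → v ∉ c.S u → 3 ≤ c.cnt u v
  snd_eq : ∀ u v, cliqueDist u v = p + 1 → v ∈ c.S u → u.2 = v.2
  notMem_S : ∀ u v, p + 2 ≤ cliqueDist u v → v ∉ c.S u
  card_known_le : ∀ u v, cliqueDist u v = p + 1 → #{m ∈ c.R u | m.1 = v.1} ≤ M
  three_le_card : ∀ u v, cliqueDist u v = p + 1 → 3 ≤ #{a | v ∈ c.R (u.1, a)}

namespace Spread

variable {M p j : ℕ} {c' : Config (Fin N × κ)}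

lemma startRanking (h : Spread M p c) (tie : Fin N × κ → (Fin N × κ) ↪ ℕ) :
    Spread M p (c.startRanking tie) where
  toValid := (h.toValid.startRanking tie).toValid
  known := h.known
  three_le_cnt := h.three_le_cnt
  snd_eq := h.snd_eq
  notMem_S := h.notMem_S
  card_known_le := h.card_known_le
  three_le_card := h.three_le_card

lemma notMem_R (h : Spread M p c) (hg : p + 3 ≤ cliqueDist u v) : v ∉ c.R u := by
  rw [h.mem_R]
  rintro (rfl | ⟨w, hw, hv⟩)
  · simp [cliqueDist_self] at hg
  · refine h.notMem_S w v ?_ hv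
    rcases cliqueDist_of_adj hw v with hsame | hnext <;> omega

lemma exists_closer_of_mem_R (h : Spread M p c) (hg : cliqueDist u v = p + 2) (hv : v ∈ c.R u) :
    u.2 = v.2 ∧ ∃ w, cliqueDist u w = 1 ∧ cliqueDist w v = p + 1 ∧ v ∈ c.S w := by
  rcases (h.mem_R u v).1 hv with rfl | ⟨w, hw, hv⟩
  · simp [cliqueDist_self] at hg
  rcases cliqueDist_of_adj hw v with hsame | ⟨hsnd, huw, hfar | hclose⟩
  · exact absurd hv (h.notMem_S w v (by omega))
  · exact absurd hv (h.notMem_S w v (by omega))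
  · exact ⟨hsnd ▸ h.snd_eq w v (by omega) hv, w, huw, by omega, hv⟩

lemma cnt_le_two (h : Spread M p c) (hg : cliqueDist u v = p + 1) : c.cnt u v ≤ 2 := by
  classical
  have hne : v ≠ u := by rintro rfl; simp [cliqueDist_self] at hg
  obtain ⟨w₀, hsnd₀, huw₀, hclose₀⟩ := exists_closer (u := u) (v := v) (by omega)
  rw [h.cnt_eq, if_neg hne, zero_add]
  -- `v` is sent only by the matched node of the next clique towards `v` and by the node in the
  -- clique of `u` that is in the layer of `v`.
  refine (Finset.card_le_card (t := {w₀, (u.1, v.2)}) fun w hw => ?_).trans Finset.card_le_two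
  obtain ⟨hw, hv⟩ := (Finset.mem_filter.1 hw).2
  rw [Finset.mem_insert, Finset.mem_singleton]
  rcases cliqueDist_of_adj hw v with ⟨hfst, hsame⟩ | ⟨hsnd, huw, hfar | hclose⟩
  · exact Or.inr (Prod.ext hfst (h.snd_eq w v (by omega) hv))
  · exact absurd hv (h.notMem_S w v (by omega))
  · exact Or.inl (Prod.ext (fst_eq_of_closer huw huw₀ hclose hclose₀) (hsnd.trans hsnd₀.symm))

lemma card_known_le_one (h : Spread M p c) (hg : cliqueDist u v = p + 2) :
    #{m ∈ c.R u | m.1 = v.1} ≤ 1 := by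
  have hsnd : ∀ m ∈ {m ∈ c.R u | m.1 = v.1}, u.2 = m.2 := fun m hm => by
    obtain ⟨hR, hfst⟩ := Finset.mem_filter.1 hm
    exact (h.exists_closer_of_mem_R (cliqueDist_congr rfl hfst ▸ hg) hR).1
  refine Finset.card_le_one.2 fun m hm m' hm' => Prod.ext ?_ ((hsnd m hm).symm.trans (hsnd m' hm'))
  exact (Finset.mem_filter.1 hm).2.trans (Finset.mem_filter.1 hm').2.symm

lemma rank_le (h : Spread M p c) (tie : Fin N × κ ↪ ℕ) (hg : cliqueDist u v = p + 1) :
    rank (c.B u) (c.cnt u) tie v ≤ 2 * M + 2 := by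
  have hfront := card_filter_cliqueDist_le (c.R u) u (p + 1) fun v => h.card_known_le u v
  have hearly := card_filter_cliqueDist_le (c.R u) u (p + 2) fun v => h.card_known_le_one (v := v)
  have hsub : {m ∈ c.B u | c.cnt u m < c.cnt u v ∨ (c.cnt u m = c.cnt u v ∧ tie m ≤ tie v)} ⊆
      {m ∈ c.R u | cliqueDist u m = p + 1} ∪ {m ∈ c.R u | cliqueDist u m = p + 2} := by
    intro m hm
    obtain ⟨hB, hm⟩ := Finset.mem_filter.1 hm
    obtain ⟨hR, hS⟩ := Config.mem_B.1 hB
    have hcnt : c.cnt u m ≤ 2 := by have := h.cnt_le_two hg; omega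
    have hnear : ¬ cliqueDist u m ≤ p := fun hp => by have := h.three_le_cnt u m hp hS; omega
    have hfar : ¬ p + 3 ≤ cliqueDist u m := fun hp => h.notMem_R hp hR
    simp only [Finset.mem_union, Finset.mem_filter, hR, true_and]
    omega
  have := (Finset.card_le_card hsub).trans (Finset.card_union_le _ _)
  unfold rank
  omega

lemma mem_R_of_closer (h : Spread M p c) (hg : cliqueDist u v = p + 2) (hv : v ∈ c.R u)
    (huw : cliqueDist u w = 1) (hwv : cliqueDist w v = p + 1) : v ∈ c.R w := by
  obtain ⟨-, w', huw', hwv', hv'⟩ := h.exists_closer_of_mem_R hg hv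
  exact h.toValid.mem_R_of_clique (fst_eq_of_closer (v := v) huw huw' (by omega) (by omega)) hv'

lemma three_le_cnt_of_sent (h : Spread M p c) (hc' : c'.Valid (cliqueRow N κ))
    (hsent : ∀ u v, cliqueDist u v = p + 1 → v ∈ c.R u → v ∈ c'.S u)
    (hg : cliqueDist u v = p + 1) (hu : v ∉ c'.S u) : 3 ≤ c'.cnt u v := by
  calc 3 ≤ #{a | v ∈ c.R (u.1, a)} := h.three_le_card u v hg
    _ ≤ #{a | v ∈ c'.S (u.1, a)} :=
      Finset.card_le_card (Finset.monotone_filter_right _ fun a _ => hsent (u.1, a) v hg)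
    _ ≤ c'.cnt u v := hc'.card_senders_le_cnt hu

lemma mem_R_of_sent (h : Spread M p c) (hc' : c'.Valid (cliqueRow N κ))
    (hsent : ∀ u v, cliqueDist u v = p + 1 → v ∈ c.R u → v ∈ c'.S u)
    (hg : cliqueDist u v = p + 1) : v ∈ c'.R u := by
  obtain ⟨a, ha⟩ := Finset.card_pos.1 (Nat.lt_of_lt_of_le zero_lt_three (h.three_le_card u v hg))
  exact hc'.mem_R_of_clique (w := (u.1, a)) rfl (hsent (u.1, a) v hg (Finset.mem_filter.1 ha).2)

lemma card_known_le_of_inPhase (h : Spread M p c) (h' : InPhase (cliqueRow N κ) c j c')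
    (hg : cliqueDist u v = p + 2) : #{m ∈ c'.R u | m.1 = v.1} ≤ M := by
  obtain ⟨w, hsnd, huw, hwv⟩ := exists_closer (u := u) (v := v) (by omega)
  refine (Finset.card_le_card fun m hm => ?_).trans (h.card_known_le w v (by omega))
  obtain ⟨hR, hm⟩ := Finset.mem_filter.1 hm
  refine Finset.mem_filter.2 ⟨?_, hm⟩
  have hum : cliqueDist u m = cliqueDist u v := cliqueDist_congr rfl hm
  have hwm : cliqueDist w m = cliqueDist w v := cliqueDist_congr rfl hm
  rcases (h'.valid.mem_R u m).1 hR with rfl | ⟨x, hx, hxm⟩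
  · simp [cliqueDist_self] at hum
    omega
  have hxR : m ∈ c.R x := h'.S_subset x hxm
  rcases cliqueDist_of_adj hx m with ⟨hfst, hsame⟩ | ⟨hsnd', hux, hfar | hclose⟩
  · exact h.mem_R_of_closer (by omega) hxR ((cliqueDist_congr hfst rfl).trans huw) (by omega)
  · exact absurd hxR (h.notMem_R (by omega))
  · obtain rfl : x = w :=
      Prod.ext (fst_eq_of_closer (v := m) hux huw hclose (by omega)) (hsnd'.trans hsnd.symm)
    exact hxR

lemma three_le_card_of_sent (h : Spread M p c) (hc' : c'.Valid (cliqueRow N κ))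
    (hsent : ∀ u v, cliqueDist u v = p + 1 → v ∈ c.R u → v ∈ c'.S u)
    (hg : cliqueDist u v = p + 2) : 3 ≤ #{a | v ∈ c'.R (u.1, a)} := by
  obtain ⟨w, -, huw, hwv⟩ := exists_closer (u := u) (v := v) (by omega)
  have hwv : cliqueDist w v = p + 1 := by omega
  refine (h.three_le_card w v hwv).trans (Finset.card_le_card ?_)
  refine Finset.monotone_filter_right _ fun a _ ha => ?_
  exact hc'.mem_R_of_adj (w := (w.1, a)) (cliqueRow_adj.2 (Or.inr ⟨rfl, huw⟩))
    (hsent (w.1, a) v hwv ha)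

lemma succ (h : Spread M p c) (h' : InPhase (cliqueRow N κ) c j c')
    (hsent : ∀ u v, cliqueDist u v = p + 1 → v ∈ c.R u → v ∈ c'.S u) : Spread M (p + 1) c' where
  toValid := h'.valid
  known u v hg := by
    rcases Nat.le_succ_iff.1 hg with hg | hg
    · exact h.toValid.R_mono h'.valid h'.S_mono u (h.known u v hg)
    · exact h.mem_R_of_sent h'.valid hsent hg
  three_le_cnt u v hg hv := by
    rcases Nat.le_succ_iff.1 hg with hg | hg
    · exact (h.three_le_cnt u v hg fun hS => hv (h'.S_mono u hS)).trans
        (h.toValid.cnt_mono h'.valid h'.S_mono u v)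
    · exact h.three_le_cnt_of_sent h'.valid hsent hg hv
  snd_eq u v hg hv := (h.exists_closer_of_mem_R hg (h'.S_subset u hv)).1
  notMem_S u v hg hv := h.notMem_R hg (h'.S_subset u hv)
  card_known_le u v hg := h.card_known_le_of_inPhase h' hg
  three_le_card u v hg := h.three_le_card_of_sent h'.valid hsent hg

lemma fullSpreading (h : Spread M N c) : c.FullSpreading := fun u v =>
  h.known u v (by unfold cliqueDist Nat.dist; omega)

end Spread

/-! ### The phases of the algorithm on a row of cliques -/

lemma Spread.le_popDist_of_inPhase {M p j : ℕ} {c' : Config (Fin N × κ)} (h : Spread M p c)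
    {tie : Fin N × κ → (Fin N × κ) ↪ ℕ} (h' : InPhase (cliqueRow N κ) (c.startRanking tie) j c')
    (hg : cliqueDist u v = p + 1) (hv : v ∈ c'.Bhat u) :
    ENNReal.ofReal (1 / ((2 * M + 2 : ℕ) * harmonic (Fintype.card (Fin N × κ)))) ≤
      popDist (c'.Bhat u) (c'.Prob u) (some v) :=
  (le_rankingFunction (h'.Bhat_subset_B_start u hv) (h.rank_le (tie u) hg)
    (Finset.card_le_univ _)).trans (h'.rankingFunction_le_popDist hv)

/-- The configurations at the end of ranking phase `p` of a run that is proceeding as planned: the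
information has spread, and `t` rounds have been executed. -/
def spreadAt (N : ℕ) (κ : Type*) [Fintype κ] [DecidableEq κ] (M p t : ℕ) :
    Set (Config (Fin N × κ)) :=
  {c | Spread M p c ∧ c.t = t}

theorem rankingPhase_spreadAt_compl_le {M p t : ℕ} (hc : c ∈ spreadAt N κ M p t)
    (tie : Fin N × κ → (Fin N × κ) ↪ ℕ) (T : ℕ) :
    (phaseRounds (cliqueRow N κ) T (c.startRanking tie)).toOuterMeasure
        (spreadAt N κ M (p + 1) (t + T))ᶜ ≤
      (Fintype.card (Fin N × κ) : ℝ≥0∞) ^ 2 *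
        ENNReal.ofReal (Real.exp
          (-(1 / ((2 * M + 2 : ℕ) * harmonic (Fintype.card (Fin N × κ))) * T))) := by
  obtain ⟨h, rfl⟩ := hc
  have hstart := h.toValid.startRanking tie
  set pairs : Finset ((Fin N × κ) × (Fin N × κ)) :=
    {x | cliqueDist x.1 x.2 = p + 1 ∧ x.2 ∈ c.B x.1}
  have hunsent : ∀ x ∈ pairs, (phaseRounds (cliqueRow N κ) T (c.startRanking tie)).toOuterMeasure
      {c' | x.2 ∉ c'.S x.1} ≤ ENNReal.ofReal (Real.exp
        (-(1 / ((2 * M + 2 : ℕ) * harmonic (Fintype.card (Fin N × κ))) * T))) := by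
    intro x hx
    obtain ⟨hg, hB⟩ := (Finset.mem_filter.1 hx).2
    simpa only [Finset.mem_singleton, forall_eq, Finset.card_singleton, Nat.cast_one, mul_one]
      using phaseRounds_keep_le hstart T {x.1} (fun _ => x.2)
        (fun u hu => by rw [Finset.mem_singleton.1 hu]; exact hB)
        fun j _ c' hc' u hu => by
          rw [Finset.mem_singleton.1 hu]
          exact h.le_popDist_of_inPhase hc' hg
  calc _ ≤ (phaseRounds (cliqueRow N κ) T (c.startRanking tie)).toOuterMeasure
        {c' | ∃ x ∈ pairs, x.2 ∉ c'.S x.1} := by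
        refine PMF.toOuterMeasure_mono _ ?_
        rintro c' ⟨hbad, hsupp⟩
        have h' := InPhase.of_mem_support_phaseRounds hstart hsupp
        by_contra! hsent
        refine hbad ⟨(h.startRanking tie).succ h' fun u v hg hv => ?_, h'.t_eq⟩
        by_cases hS : v ∈ c.S u
        · exact h'.S_mono u hS
        · by_contra hS'
          exact hsent ⟨(u, v), Finset.mem_filter.2
            ⟨Finset.mem_univ _, hg, Config.mem_B.2 ⟨hv, hS⟩⟩, hS'⟩
    _ ≤ #pairs * _ := toOuterMeasure_exists_mem_le _ _ _ hunsent
    _ ≤ _ := by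
        gcongr
        exact_mod_cast (Finset.card_le_univ pairs).trans_eq (by rw [Fintype.card_prod, sq])

namespace InPhase

variable {j : ℕ} (h : InPhase (cliqueRow N κ) (randomStart (cliqueRow N κ)) j c)
include h

lemma cliqueDist_le_one (hv : v ∈ c.S u) : cliqueDist u v ≤ 1 := by
  rcases h.eq_or_adj_of_mem_S hv with rfl | hadj
  · exact (cliqueDist_self v).trans_le zero_le_one
  · rcases cliqueRow_adj.1 hadj with ⟨hfst, -⟩ | ⟨-, hdist⟩
    · exact (cliqueDist_eq_zero.2 hfst).trans_le zero_le_one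
    · exact hdist.le

lemma snd_eq_of_cliqueDist_eq_one (hg : cliqueDist u v = 1) (hv : v ∈ c.S u) : u.2 = v.2 := by
  rcases h.eq_or_adj_of_mem_S hv with rfl | hadj
  · simp [cliqueDist_self] at hg
  · rcases cliqueRow_adj.1 hadj with ⟨hfst, -⟩ | ⟨hsnd, -⟩
    · simp [cliqueDist_eq_zero.2 hfst] at hg
    · exact hsnd

lemma mem_S_of_mem_R (hg : cliqueDist u m = 1) (hm : m ∈ c.R u) :
    m ∈ c.S (m.1, u.2) ∨ m ∈ c.S (u.1, m.2) := by
  rcases (h.valid.mem_R u m).1 hm with rfl | ⟨w, hw, hm⟩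
  · simp [cliqueDist_self] at hg
  have hwm := h.cliqueDist_le_one hm
  rcases cliqueDist_of_adj hw m with ⟨hfst, hsame⟩ | ⟨hsnd, -, hfar | hclose⟩
  · have hsnd := h.snd_eq_of_cliqueDist_eq_one (hsame.trans hg) hm
    obtain rfl : w = (u.1, m.2) := Prod.ext hfst hsnd
    exact Or.inr hm
  · omega
  · have hfst : w.1 = m.1 := cliqueDist_eq_zero.1 (by omega)
    obtain rfl : w = (m.1, u.2) := Prod.ext hfst hsnd
    exact Or.inl hm

lemma card_known_le {Y : ℕ}
    (hcross : #{b | (v.1, b) ∈ c.S (u.1, b)} ≤ Y) (hg : cliqueDist u v = 1) :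
    #{m ∈ c.R u | m.1 = v.1} ≤ 1 + j + Y := by
  calc #{m ∈ c.R u | m.1 = v.1}
    _ ≤ #(c.S (v.1, u.2) ∪ ({b | (v.1, b) ∈ c.S (u.1, b)} : Finset κ).map
          (Function.Embedding.sectR v.1 κ)) := by
        refine Finset.card_le_card fun m hm => ?_
        obtain ⟨hR, hfst⟩ := Finset.mem_filter.1 hm
        rw [Finset.mem_union, Finset.mem_map]
        rcases h.mem_S_of_mem_R ((cliqueDist_congr rfl hfst).trans hg) hR with hS | hS
        · exact Or.inl (hfst ▸ hS)
        · have hm : (v.1, m.2) = m := Prod.ext hfst.symm rfl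
          exact Or.inr ⟨m.2, by simpa [hm] using hS, hm⟩
    _ ≤ #(c.S (v.1, u.2)) + #{b | (v.1, b) ∈ c.S (u.1, b)} := by
        rw [← Finset.card_map (Function.Embedding.sectR v.1 κ)]
        exact Finset.card_union_le _ _
    _ ≤ 1 + j + Y := add_le_add (h.card_S_le_one_add _) hcross

lemma spread_zero {Y : ℕ} (hthree : ∀ v, 3 ≤ #{a | v ∈ c.S (v.1, a)})
    (hcross : ∀ u v : Fin N × κ, cliqueDist u v = 1 → #{b | (v.1, b) ∈ c.S (u.1, b)} ≤ Y) :
    Spread (1 + j + Y) 0 c where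
  toValid := h.valid
  known u v hg := by
    obtain ⟨a, ha⟩ := Finset.card_pos.1 (Nat.lt_of_lt_of_le zero_lt_three (hthree v))
    have hfst : u.1 = v.1 := cliqueDist_eq_zero.1 (by omega)
    exact h.valid.mem_R_of_clique (w := (v.1, a)) hfst (Finset.mem_filter.1 ha).2
  three_le_cnt u v hg hv := by
    have hfst : u.1 = v.1 := cliqueDist_eq_zero.1 (by omega)
    exact (hfst ▸ hthree v).trans (h.valid.card_senders_le_cnt hv)
  snd_eq u v hg hv := h.snd_eq_of_cliqueDist_eq_one hg hv
  notMem_S u v hg hv := by have := h.cliqueDist_le_one hv; omega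
  card_known_le u v hg := h.card_known_le (hcross u v hg) hg
  three_le_card u v hg := (hthree v).trans <| Finset.card_le_card <|
    Finset.monotone_filter_right _ fun a _ ha =>
      h.valid.mem_R_of_adj (w := (v.1, a)) (cliqueRow_adj.2 (Or.inr ⟨rfl, hg⟩)) ha

lemma card_Bhat_le (u : Fin N × κ) : #(c.Bhat u) ≤ Fintype.card κ + 2 := by
  have hsub : c.Bhat u ⊆ Finset.univ.map (Function.Embedding.sectR u.1 κ) ∪
      ({m | m.2 = u.2 ∧ cliqueDist u m = 1} : Finset (Fin N × κ)) := by
    intro m hm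
    rw [Finset.mem_union, Finset.mem_map]
    rcases cliqueRow_adj.1 (mem_randomStart_B.1 (h.Bhat_subset_B_start u hm)) with
      ⟨hfst, -⟩ | ⟨hsnd, hdist⟩
    · exact Or.inl ⟨m.2, Finset.mem_univ _, Prod.ext hfst rfl⟩
    · exact Or.inr (by simp [hsnd, hdist])
  have hmatched := card_filter_cliqueDist_le (M := 1) {m : Fin N × κ | m.2 = u.2} u 1
    fun v _ => Finset.card_le_one.2 fun m hm m' hm' => by
      simp only [Finset.mem_filter, Finset.mem_univ, true_and] at hm hm'
      exact Prod.ext (hm.2.trans hm'.2.symm) (hm.1.trans hm'.1.symm)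
  rw [Finset.filter_filter] at hmatched
  refine (Finset.card_le_card hsub).trans ((Finset.card_union_le _ _).trans ?_)
  rw [Finset.card_map, Finset.card_univ]
  omega

lemma card_le_card_Bhat_add (u : Fin N × κ) : Fintype.card κ ≤ #(c.Bhat u) + (2 + j) := by
  have hsub : (Finset.univ.erase u.2).map (Function.Embedding.sectR u.1 κ) ⊆
      (randomStart (cliqueRow N κ)).B u := fun v hv => by
    obtain ⟨a, ha, rfl⟩ := Finset.mem_map.1 hv
    exact mem_randomStart_B.2 (cliqueRow_adj.2 (Or.inl ⟨rfl, (Finset.ne_of_mem_erase ha).symm⟩))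
  have hcard := Finset.card_le_card hsub
  rw [Finset.card_map, Finset.card_erase_of_mem (Finset.mem_univ _), Finset.card_univ] at hcard
  have hsent := h.card_S_le_one_add u
  have hleft := Finset.le_card_sdiff (c.S u) ((randomStart (cliqueRow N κ)).B u)
  rw [← h.Bhat_eq] at hleft
  omega

lemma le_popDist (hv : v ∈ c.Bhat u) :
    ENNReal.ofReal (1 / ((Fintype.card κ + 2 : ℕ) : ℝ)) ≤
      popDist (c.Bhat u) (c.Prob u) (some v) := by
  rw [h.popDist_of_startRandom hv, one_div, ENNReal.ofReal_inv_of_pos (by positivity),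
    ENNReal.ofReal_natCast]
  exact ENNReal.inv_le_inv.2 (Nat.cast_le.2 (h.card_Bhat_le u))

lemma popDist_le {τ : ℕ} (hj : j < τ) (hτ : (τ + 1 : ℝ) < Fintype.card κ) (hv : v ∈ c.Bhat u) :
    popDist (c.Bhat u) (c.Prob u) (some v) ≤
      ENNReal.ofReal (1 / ((Fintype.card κ : ℝ) - (τ + 1))) := by
  have hcard : (Fintype.card κ : ℝ) ≤ #(c.Bhat u) + (τ + 1) := by
    have := h.card_le_card_Bhat_add u
    exact_mod_cast show Fintype.card κ ≤ #(c.Bhat u) + (τ + 1) by omega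
  rw [h.popDist_of_startRandom hv, one_div, ENNReal.ofReal_inv_of_pos (sub_pos.2 hτ),
    ← ENNReal.ofReal_natCast]
  exact ENNReal.inv_le_inv.2 (ENNReal.ofReal_le_ofReal (by linarith))

end InPhase

/-- The law of the configuration at the end of a random phase of length `τ`. -/
noncomputable abbrev randomPhase (N : ℕ) (κ : Type*) [Fintype κ] [DecidableEq κ] (τ : ℕ) :
    PMF (Config (Fin N × κ)) :=
  phaseRounds (cliqueRow N κ) τ (randomStart (cliqueRow N κ))

lemma randomPhase_unsent_le (hκ : 4 ≤ Fintype.card κ) (τ : ℕ) (v : Fin N × κ) (a₀ : κ) :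
    (randomPhase N κ τ).toOuterMeasure {c | ∀ a, a ≠ v.2 → a ≠ a₀ → v ∉ c.S (v.1, a)} ≤
      ENNReal.ofReal (Real.exp (-(τ / 4 : ℝ))) := by
  set W : Finset (Fin N × κ) := ({v.2, a₀}ᶜ : Finset κ).map (Function.Embedding.sectR v.1 κ)
  have hW : Fintype.card κ ≤ #W + 2 := by
    have := Finset.card_le_two (a := v.2) (b := a₀)
    rw [Finset.card_map, Finset.card_compl]
    omega
  have hB : ∀ w ∈ W, v ∈ (randomStart (cliqueRow N κ)).B w := by
    intro w hw
    obtain ⟨a, ha, rfl⟩ := Finset.mem_map.1 hw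
    simp only [Finset.mem_compl, Finset.mem_insert, not_or] at ha
    exact mem_randomStart_B.2 (cliqueRow_adj.2 (Or.inl ⟨rfl, ha.1⟩))
  have hrate : (τ / 4 : ℝ) ≤ 1 / ((Fintype.card κ + 2 : ℕ) : ℝ) * #W * τ := by
    have hW' : (Fintype.card κ : ℝ) ≤ #W + 2 := mod_cast hW
    have hκ' : (4 : ℝ) ≤ Fintype.card κ := mod_cast hκ
    have : (1 / 4 : ℝ) ≤ 1 / ((Fintype.card κ + 2 : ℕ) : ℝ) * #W := by
      rw [one_div_mul_eq_div, le_div_iff₀ (by positivity)]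
      push_cast
      linarith
    calc (τ / 4 : ℝ) = 1 / 4 * τ := by ring
      _ ≤ _ := by gcongr
  calc _ ≤ (randomPhase N κ τ).toOuterMeasure {c | ∀ w ∈ W, v ∉ c.S w} := by
        refine MeasureTheory.measure_mono fun c hc w hw => ?_
        obtain ⟨a, ha, rfl⟩ := Finset.mem_map.1 hw
        simp only [Finset.mem_compl, Finset.mem_insert, Finset.mem_singleton, not_or] at ha
        exact hc a ha.1 ha.2
    _ ≤ _ := phaseRounds_keep_le (randomStart_phaseStart _) τ W (fun _ => v) hB
        fun _ _ _ hc _ _ => hc.le_popDist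
    _ ≤ _ := ENNReal.ofReal_le_ofReal (Real.exp_le_exp.2 (neg_le_neg hrate))

lemma ofReal_exp_div_two_pow_le {x : ℝ} (hx : x ≤ 9 / 8) (τ : ℕ) :
    ENNReal.ofReal (Real.exp (x * τ)) / 2 ^ (2 * τ + 1) ≤
      ENNReal.ofReal (Real.exp (-(τ / 4 : ℝ))) := by
  have hexp : Real.exp (11 / 16) ≤ 2 := by
    rw [← Real.le_log_iff_exp_le two_pos]
    linarith [Real.log_two_gt_d9]
  have htwo : (2 : ℝ≥0∞) ^ (2 * τ + 1) = ENNReal.ofReal (2 ^ (2 * τ + 1)) := by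
    rw [ENNReal.ofReal_pow zero_le_two, ENNReal.ofReal_ofNat]
  rw [htwo, ← ENNReal.ofReal_div_of_pos (by positivity)]
  refine ENNReal.ofReal_le_ofReal ((div_le_iff₀ (by positivity)).2 ?_)
  calc Real.exp (x * τ) ≤ Real.exp (9 / 8 * τ) := by gcongr
    _ = Real.exp (-(τ / 4 : ℝ)) * Real.exp (11 / 16) ^ (2 * τ) := by
        rw [← Real.exp_nat_mul, ← Real.exp_add]
        push_cast
        ring_nf
    _ ≤ Real.exp (-(τ / 4 : ℝ)) * 2 ^ (2 * τ) := by gcongr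
    _ ≤ Real.exp (-(τ / 4 : ℝ)) * 2 ^ (2 * τ + 1) := by
        gcongr
        · exact one_le_two
        · exact Nat.le_succ _

lemma randomPhase_many_matched_le {τ : ℕ} (hκ : 9 * (τ + 1) ≤ Fintype.card κ)
    (huv : cliqueDist u v = 1) :
    (randomPhase N κ τ).toOuterMeasure {c | 2 * τ + 1 ≤ #{b | (v.1, b) ∈ c.S (u.1, b)}} ≤
      ENNReal.ofReal (Real.exp (-(τ / 4 : ℝ))) := by
  set W : Finset (Fin N × κ) := Finset.univ.map (Function.Embedding.sectR u.1 κ)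
  have hκ' : (9 : ℝ) * (τ + 1) ≤ Fintype.card κ := mod_cast hκ
  have hpos : (0 : ℝ) < (Fintype.card κ : ℝ) - (τ + 1) := by linarith
  have hB : ∀ w ∈ W, (v.1, w.2) ∈ (randomStart (cliqueRow N κ)).B w := by
    intro w hw
    obtain ⟨b, -, rfl⟩ := Finset.mem_map.1 hw
    exact mem_randomStart_B.2 (cliqueRow_adj.2 (Or.inr ⟨rfl, huv⟩))
  have hrate : 1 / ((Fintype.card κ : ℝ) - (τ + 1)) * #W ≤ 9 / 8 := by
    rw [Finset.card_map, Finset.card_univ, one_div_mul_eq_div, div_le_iff₀ hpos]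
    linarith
  have hmany := phaseRounds_many_le (randomStart_phaseStart _) τ W (fun w => (v.1, w.2)) hB
    (by positivity) (fun j hj c hc w _ => hc.popDist_le hj (by linarith)) (2 * τ + 1)
  simp only [W, Finset.filter_map, Finset.card_map] at hmany
  exact hmany.trans (ofReal_exp_div_two_pow_le (by simpa only [W, Finset.card_map] using hrate) τ)

lemma randomPhase_exists_unsent_le (hκ : 4 ≤ Fintype.card κ) (τ : ℕ) :
    (randomPhase N κ τ).toOuterMeasure
        {c | ∃ v, ∃ a₀, ∀ a, a ≠ v.2 → a ≠ a₀ → v ∉ c.S (v.1, a)} ≤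
      (Fintype.card (Fin N × κ) : ℝ≥0∞) ^ 2 * ENNReal.ofReal (Real.exp (-(τ / 4 : ℝ))) := by
  have hunion := toOuterMeasure_exists_mem_le (randomPhase N κ τ) Finset.univ _
    fun (x : (Fin N × κ) × (Fin N × κ)) _ => randomPhase_unsent_le hκ τ x.1 x.2.2
  rw [Finset.card_univ, Fintype.card_prod, Nat.cast_mul, ← sq] at hunion
  refine (MeasureTheory.measure_mono ?_).trans hunion
  rintro c ⟨v, a₀, hc⟩
  exact ⟨(v, (v.1, a₀)), Finset.mem_univ _, hc⟩

lemma randomPhase_exists_many_matched_le {τ : ℕ} (hκ : 9 * (τ + 1) ≤ Fintype.card κ) :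
    (randomPhase N κ τ).toOuterMeasure
        {c | ∃ u v : Fin N × κ, cliqueDist u v = 1 ∧ 2 * τ + 1 ≤ #{b | (v.1, b) ∈ c.S (u.1, b)}} ≤
      (Fintype.card (Fin N × κ) : ℝ≥0∞) ^ 2 * ENNReal.ofReal (Real.exp (-(τ / 4 : ℝ))) := by
  set pairs : Finset ((Fin N × κ) × (Fin N × κ)) := {x | cliqueDist x.1 x.2 = 1}
  have hunion := toOuterMeasure_exists_mem_le (randomPhase N κ τ) pairs _ fun x hx =>
    randomPhase_many_matched_le hκ (Finset.mem_filter.1 hx).2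
  have hpairs : (#pairs : ℝ≥0∞) ≤ (Fintype.card (Fin N × κ) : ℝ≥0∞) ^ 2 := by
    exact_mod_cast (Finset.card_le_univ pairs).trans_eq (by rw [Fintype.card_prod, sq])
  refine (MeasureTheory.measure_mono ?_).trans (hunion.trans (mul_le_mul_left hpairs _))
  rintro c ⟨u, v, huv, hc⟩
  exact ⟨(u, v), Finset.mem_filter.2 ⟨Finset.mem_univ _, huv⟩, hc⟩

theorem randomPhase_spreadAt_compl_le {τ : ℕ} (hκ : 9 * (τ + 1) ≤ Fintype.card κ) :
    (randomPhase N κ τ).toOuterMeasure (spreadAt N κ (3 * τ + 1) 0 (1 + τ))ᶜ ≤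
      2 * ((Fintype.card (Fin N × κ) : ℝ≥0∞) ^ 2 *
        ENNReal.ofReal (Real.exp (-(τ / 4 : ℝ)))) := by
  refine le_trans (PMF.toOuterMeasure_mono (t :=
    {c | ∃ v, ∃ a₀, ∀ a, a ≠ v.2 → a ≠ a₀ → v ∉ c.S (v.1, a)} ∪
    {c | ∃ u v : Fin N × κ, cliqueDist u v = 1 ∧
      2 * τ + 1 ≤ #{b | (v.1, b) ∈ c.S (u.1, b)}}) _ ?_) ?_
  · rw [show 3 * τ + 1 = 1 + τ + 2 * τ by ring]
    rintro c ⟨hbad, hsupp⟩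
    have h := InPhase.of_mem_support_phaseRounds (randomStart_phaseStart _) hsupp
    by_contra hno
    simp only [Set.mem_union, Set.mem_ofPred_eq, not_or] at hno
    push Not at hno
    obtain ⟨hsent, hmatched⟩ := hno
    refine hbad ⟨h.spread_zero (fun v => ?_) fun u v huv => Nat.le_of_lt_succ (hmatched u v huv),
      h.t_eq⟩
    refine two_lt_card_of_forall_exists (a := v.2) (by simpa using h.self_mem_S v) fun b => ?_
    obtain ⟨a, hav, hab, ha⟩ := hsent v b
    exact ⟨a, by simpa using ha, hav, hab⟩
  · have hκ₄ : 4 ≤ Fintype.card κ := by omega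
    exact (MeasureTheory.measure_union_le _ _).trans
      ((add_le_add (randomPhase_exists_unsent_le hκ₄ τ)
        (randomPhase_exists_many_matched_le hκ)).trans_eq (two_mul _).symm)

/-! ### The basic algorithm -/

theorem basicAlgorithm_spreadAt_compl_le {τ : ℕ} (hκ : 9 * (τ + 1) ≤ Fintype.card κ) (τ' : ℕ)
    (tie : Config (Fin N × κ) → Fin N × κ → (Fin N × κ) ↪ ℕ) (p : ℕ) :
    (basicAlgorithm (cliqueRow N κ) τ τ' tie p).toOuterMeasure
        (spreadAt N κ (3 * τ + 1) p (1 + τ + p * τ'))ᶜ ≤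
      2 * ((Fintype.card (Fin N × κ) : ℝ≥0∞) ^ 2 * ENNReal.ofReal (Real.exp (-(τ / 4 : ℝ)))) +
        p * ((Fintype.card (Fin N × κ) : ℝ≥0∞) ^ 2 * ENNReal.ofReal (Real.exp
          (-(1 / ((2 * (3 * τ + 1) + 2 : ℕ) * harmonic (Fintype.card (Fin N × κ))) * τ')))) := by
  induction p with
  | zero =>
    rw [zero_mul, add_zero, Nat.cast_zero, zero_mul, add_zero]
    exact randomPhase_spreadAt_compl_le hκ
  | succ p ih =>
    rw [basicAlgorithm, add_one_mul p τ', ← add_assoc, Nat.cast_succ, add_one_mul (p : ℝ≥0∞),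
      ← add_assoc]
    exact (toOuterMeasure_bind_le _ _ _ _ fun c hc =>
      rankingPhase_spreadAt_compl_le hc (tie c) τ').trans (add_le_add_left ih _)

end CliqueRow
section Parameters

variable {c α d : ℝ} {n k : ℕ}

lemma four_le_logb (hn : 16 ≤ n) : 4 ≤ Real.logb 2 n := by
  have hn' : (16 : ℝ) ≤ n := mod_cast hn
  rw [Real.le_logb_iff_rpow_le one_lt_two (by linarith)]
  norm_num
  exact hn

lemma log_le_mul_logb {x : ℝ} (hx : 1 ≤ x) : Real.log x ≤ 3 / 4 * Real.logb 2 x := by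
  have hlog : Real.log x = Real.log 2 * Real.logb 2 x :=
    (mul_div_cancel₀ _ (Real.log_pos one_lt_two).ne').symm
  rw [hlog]
  gcongr
  · exact Real.logb_nonneg one_lt_two hx
  · linarith [Real.log_two_lt_d9]

lemma harmonic_le_logb (hn : 16 ≤ n) : (harmonic n : ℝ) ≤ Real.logb 2 n := by
  have hlog := log_le_mul_logb (x := n) (by exact_mod_cast (by omega : 1 ≤ n))
  linarith [harmonic_le_one_add_log n, four_le_logb hn]

lemma exp_neg_le_rpow_neg {x y s : ℝ} (hx : 1 ≤ x) (hs : 0 ≤ s)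
    (hy : 3 / 4 * s * Real.logb 2 x ≤ y) : Real.exp (-y) ≤ x ^ (-s) := by
  rw [Real.rpow_def_of_pos (by linarith), mul_neg]
  refine Real.exp_le_exp.2 (neg_le_neg ?_)
  calc Real.log x * s ≤ 3 / 4 * Real.logb 2 x * s := by gcongr; exact log_le_mul_logb hx
    _ = 3 / 4 * s * Real.logb 2 x := by ring
    _ ≤ y := hy

lemma mul_logb_le_randomPhaseLength_div_four (hα : 3 * (c + 3) ≤ α) (hn : 16 ≤ n) :
    3 / 4 * (c + 3) * Real.logb 2 n ≤ randomPhaseLength α n / 4 := by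
  have hL := four_le_logb hn
  calc 3 / 4 * (c + 3) * Real.logb 2 n = 3 * (c + 3) * Real.logb 2 n / 4 := by ring
    _ ≤ α * Real.logb 2 n / 4 := by gcongr
    _ ≤ randomPhaseLength α n / 4 := by gcongr; exact Nat.le_ceil _

lemma mul_logb_le_rankingPhaseLength_mul (hd : 0 ≤ d) (hτ : 2 ≤ randomPhaseLength α n)
    (hn : 16 ≤ n) :
    d * Real.logb 2 n ≤ 1 / ((2 * (3 * randomPhaseLength α n + 1) + 2 : ℕ) * harmonic n) *
      rankingPhaseLength α d n := by
  have hL := four_le_logb hn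
  have hτ' : (2 : ℝ) ≤ randomPhaseLength α n := mod_cast hτ
  have hH : (0 : ℝ) < harmonic n := mod_cast harmonic_pos (by omega : n ≠ 0)
  rw [one_div_mul_eq_div, le_div_iff₀ (by positivity)]
  calc d * Real.logb 2 n * ((2 * (3 * randomPhaseLength α n + 1) + 2 : ℕ) * harmonic n)
    _ ≤ d * Real.logb 2 n * (8 * randomPhaseLength α n * Real.logb 2 n) := by
        gcongr
        · push_cast
          linarith
        · exact harmonic_le_logb hn
    _ = 8 * d * randomPhaseLength α n * Real.logb 2 n ^ 2 := by ring
    _ ≤ rankingPhaseLength α d n := Nat.le_ceil _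

lemma union_bound_le {N : ℕ} {x y : ℝ} (hn : 0 < n) (hN : N + 2 ≤ n)
    (hx : x ≤ (n : ℝ) ^ (-(c + 3))) (hy : y ≤ (n : ℝ) ^ (-(c + 3))) :
    2 * ((n : ℝ≥0∞) ^ 2 * ENNReal.ofReal x) + N * ((n : ℝ≥0∞) ^ 2 * ENNReal.ofReal y) ≤
      ENNReal.ofReal (1 / (n : ℝ) ^ c) := by
  have hn' : (0 : ℝ) < n := mod_cast hn
  have hN' : ((2 + N : ℕ) : ℝ≥0∞) ≤ n := mod_cast (by omega : 2 + N ≤ n)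
  calc _ ≤ 2 * ((n : ℝ≥0∞) ^ 2 * ENNReal.ofReal ((n : ℝ) ^ (-(c + 3)))) +
        N * ((n : ℝ≥0∞) ^ 2 * ENNReal.ofReal ((n : ℝ) ^ (-(c + 3)))) := by gcongr
    _ = (2 + N : ℕ) * ((n : ℝ≥0∞) ^ 2 * ENNReal.ofReal ((n : ℝ) ^ (-(c + 3)))) := by
        rw [← add_mul]
        push_cast
        rfl
    _ ≤ n * ((n : ℝ≥0∞) ^ 2 * ENNReal.ofReal ((n : ℝ) ^ (-(c + 3)))) := by gcongr
    _ = ENNReal.ofReal ((n : ℝ) ^ 3 * (n : ℝ) ^ (-(c + 3))) := by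
        rw [ENNReal.ofReal_mul (by positivity), ENNReal.ofReal_pow hn'.le, ENNReal.ofReal_natCast]
        ring
    _ = ENNReal.ofReal (1 / (n : ℝ) ^ c) := by
        rw [← Real.rpow_ofNat, ← Real.rpow_add hn', one_div, ← Real.rpow_neg hn'.le]
        congr 2
        ring

lemma rounds_le {L τ τ' N : ℝ} (hα : 0 ≤ α) (hd : 0 ≤ d) (hL : 1 ≤ L) (hN : 1 ≤ N)
    (hτ : τ ≤ α * L + 1) (hτ' : τ' ≤ 8 * d * τ * L ^ 2 + 1) :
    1 + τ + N * τ' ≤ (8 * d * (α + 1) + α + 3) * (N * L ^ 3) := by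
  have hL₃ : 1 ≤ L ^ 3 := one_le_pow₀ hL
  have hLL₃ : L ≤ L ^ 3 := le_self_pow₀ hL (by norm_num)
  have hrandom : 1 + τ ≤ (α + 2) * (N * L ^ 3) := by
    calc 1 + τ ≤ (α + 2) * L := by linarith
      _ ≤ (α + 2) * (1 * L ^ 3) := by rw [one_mul]; gcongr
      _ ≤ (α + 2) * (N * L ^ 3) := by gcongr
  have hranking : τ' ≤ (8 * d * (α + 1) + 1) * L ^ 3 := by
    calc τ' ≤ 8 * d * τ * L ^ 2 + 1 := hτ'
      _ ≤ 8 * d * ((α + 1) * L) * L ^ 2 + L ^ 3 := by gcongr; linarith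
      _ = (8 * d * (α + 1) + 1) * L ^ 3 := by ring
  calc 1 + τ + N * τ' ≤ (α + 2) * (N * L ^ 3) + N * ((8 * d * (α + 1) + 1) * L ^ 3) := by gcongr
    _ = (8 * d * (α + 1) + α + 3) * (N * L ^ 3) := by ring

lemma card_cliqueRow (hdvd : k ∣ n) : Fintype.card (Fin (n / k) × Fin k) = n := by
  rw [Fintype.card_prod, Fintype.card_fin, Fintype.card_fin, Nat.div_mul_cancel hdvd]

lemma two_le_randomPhaseLength (hα : 1 ≤ α) (hn : 16 ≤ n) : 2 ≤ randomPhaseLength α n := by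
  refine Nat.lt_ceil.2 ?_
  push_cast
  nlinarith [four_le_logb hn]

lemma randomPhaseLength_le (hα : 0 ≤ α) (hn : 16 ≤ n) :
    (randomPhaseLength α n : ℝ) ≤ α * Real.logb 2 n + 1 :=
  (Nat.ceil_lt_add_one (mul_nonneg hα (by linarith [four_le_logb hn]))).le

lemma rankingPhaseLength_le (hd : 0 ≤ d) : (rankingPhaseLength α d n : ℝ) ≤
    8 * d * randomPhaseLength α n * Real.logb 2 n ^ 2 + 1 :=
  (Nat.ceil_lt_add_one (by positivity)).le

lemma nine_mul_randomPhaseLength_le (hα : 0 ≤ α) (hn : 16 ≤ n)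
    (hk : 9 * (α + 1) * Real.logb 2 n ≤ k) : 9 * (randomPhaseLength α n + 1) ≤ k := by
  have hτ := randomPhaseLength_le hα hn
  have hL := four_le_logb hn
  exact_mod_cast (by push_cast; linarith :
    ((9 * (randomPhaseLength α n + 1) : ℕ) : ℝ) ≤ k)

theorem basicAlgorithm_graphNK_compl_le (hc : 0 ≤ c) (hα : 3 * (c + 3) ≤ α)
    (hd : 3 / 4 * (c + 3) ≤ d) (hn : 16 ≤ n) (hk : 9 * (α + 1) * Real.logb 2 n ≤ k)
    (hdvd : k ∣ n)
    (tie : Config (Fin (n / k) × Fin k) → Fin (n / k) × Fin k → (Fin (n / k) × Fin k) ↪ ℕ) :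
    (basicAlgorithm (graphNK n k) (randomPhaseLength α n) (rankingPhaseLength α d n) tie
        (n / k)).toOuterMeasure
      (spreadAt (n / k) (Fin k) (3 * randomPhaseLength α n + 1) (n / k)
        (1 + randomPhaseLength α n + n / k * rankingPhaseLength α d n))ᶜ ≤
      ENNReal.ofReal (1 / (n : ℝ) ^ c) := by
  have hn' : (1 : ℝ) ≤ n := mod_cast (by omega : 1 ≤ n)
  have hL := four_le_logb hn
  have hτk := nine_mul_randomPhaseLength_le (by linarith) hn hk
  have hN : n / k + 2 ≤ n := by
    have : n / k ≤ n / 2 := Nat.div_le_div_left (by omega) two_pos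
    omega
  have hfail := basicAlgorithm_spreadAt_compl_le (by rwa [Fintype.card_fin])
    (rankingPhaseLength α d n) tie (n / k)
  rw [card_cliqueRow hdvd] at hfail
  refine hfail.trans (union_bound_le (by omega) hN ?_ ?_)
  · exact exp_neg_le_rpow_neg hn' (by linarith) (mul_logb_le_randomPhaseLength_div_four hα hn)
  · refine exp_neg_le_rpow_neg hn' (by linarith) (le_trans (b := d * Real.logb 2 n) (by gcongr) ?_)
    exact mul_logb_le_rankingPhaseLength_mul (by linarith)
      (two_le_randomPhaseLength (by linarith) hn) hn

theorem mainTheorem2_general (hc : 0 ≤ c) (hα : 3 * (c + 3) ≤ α) (hd : 3 / 4 * (c + 3) ≤ d)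
    (hn : 16 ≤ n) (hk : 9 * (α + 1) * Real.logb 2 n ≤ k) (hdvd : k ∣ n)
    (tie : Config (Fin (n / k) × Fin k) → Fin (n / k) × Fin k → (Fin (n / k) × Fin k) ↪ ℕ) :
    1 - 1 / (n : ℝ) ^ c ≤
      ((basicAlgorithm (graphNK n k) (randomPhaseLength α n) (rankingPhaseLength α d n)
          tie (n / k)).toOuterMeasure
        {s | s.FullSpreading ∧
          (s.t : ℝ) ≤ (8 * d * (α + 1) + α + 3) *
            ((n : ℝ) * Real.logb 2 n ^ 3 / (k : ℝ))}).toReal := by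
  have hL := four_le_logb hn
  have hτk := nine_mul_randomPhaseLength_le (by linarith) hn hk
  refine one_sub_le_toReal_toOuterMeasure (by positivity) ((MeasureTheory.measure_mono ?_).trans
    (basicAlgorithm_graphNK_compl_le hc hα hd hn hk hdvd tie))
  refine Set.compl_subset_compl.2 fun s hs => ⟨hs.1.fullSpreading, ?_⟩
  have hN : 1 ≤ n / k := Nat.div_pos (Nat.le_of_dvd (by omega) hdvd) (by omega)
  rw [hs.2, mul_div_right_comm, ← Nat.cast_div hdvd (by exact_mod_cast (by omega : k ≠ 0))]
  push_cast
  exact rounds_le (by linarith) (by linarith) (by linarith) (by exact_mod_cast hN)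
    (randomPhaseLength_le (by linarith) hn) (rankingPhaseLength_le (by linarith))

end Parameters

lemma eventually_mul_logb_le_of_isLittleO {k : ℕ → ℕ}
    (hk : (fun n : ℕ => Real.logb 2 n ^ 3) =o[Filter.atTop] (fun n : ℕ => (k n : ℝ)))
    {A : ℝ} (hA : 0 < A) : ∀ᶠ n : ℕ in Filter.atTop, A * Real.logb 2 n ≤ k n := by
  filter_upwards [hk.def (inv_pos.2 hA), Filter.eventually_ge_atTop 16] with n hkn hn
  have hL := four_le_logb hn
  rw [Real.norm_of_nonneg (by positivity), Real.norm_of_nonneg (by positivity),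
    inv_mul_eq_div, le_div_iff₀ hA] at hkn
  calc A * Real.logb 2 n ≤ A * Real.logb 2 n ^ 3 := by
        gcongr
        exact le_self_pow₀ (by linarith) (by norm_num)
    _ ≤ k n := by rwa [mul_comm]

end VertexCongest

theorem mainTheorem2 (c α d : ℝ) (hc : 1 ≤ c) (hα : 48 * c + 96 < α) (hd : c + 3 < d) :
    ∃ C : ℝ, ∀ k : ℕ → ℕ,
      (fun n : ℕ => Real.logb 2 n ^ 3) =o[Filter.atTop] (fun n : ℕ => (k n : ℝ)) →
      ∀ᶠ n : ℕ in Filter.atTop, k n ∣ n →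
        ∀ tie : Config (Fin (n / k n) × Fin (k n)) →
            Fin (n / k n) × Fin (k n) → (Fin (n / k n) × Fin (k n)) ↪ ℕ,
          1 - 1 / (n : ℝ) ^ c ≤
            ((basicAlgorithm (graphNK n (k n)) (randomPhaseLength α n) (rankingPhaseLength α d n)
                tie (n / k n)).toOuterMeasure
              {s | s.FullSpreading ∧
                (s.t : ℝ) ≤ C * ((n : ℝ) * Real.logb 2 n ^ 3 / (k n : ℝ))}).toReal := by
  refine ⟨8 * d * (α + 1) + α + 3, fun k hk => ?_⟩
  filter_upwards [eventually_mul_logb_le_of_isLittleO hk (by linarith : 0 < 9 * (α + 1)),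
    Filter.eventually_ge_atTop 16] with n hkn hn hdvd tie
  exact mainTheorem2_general (by linarith) (by linarith) (by linarith) hn hkn hdvd tie
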